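/- **Curvature of a $D_a$-homothetically deformed $(\kappa,\mu,\nu)$-contact metric manifold of dimension 3.** An almost contact metric manifold $(M,\phi,\xi,\eta,g)$ is a smooth Riemannian manifold with a smooth $(1,1)$-tensor field $\phi$, a smooth vector field $\xi$ and a smooth 1-form $\eta$ such that $\eta(\xi)=1$, $\phi^2X=-X+\eta(X)\xi$ and $g(\phi X,\phi Y)=g(X,Y)-\eta(X)\eta(Y)$. It is a contact metric manifold if $d\eta(X,Y)=g(X,\phi Y)$, where $d\eta(X,Y)=\frac12\big(X\eta(Y)-Y\eta(X)-\eta([X,Y])\big)$. Put $h=\frac12 L_\xi\phi$ and $R(X,Y)Z=\nabla_X\nabla_YZ-\nabla_Y\nabla_XZ-\nabla_{[X,Y]}Z$, where $\nabla$ is the Levi-Civita connection of $g$. A contact metric manifold is a $(\kappa,\mu,\nu)$-contact metric manifold, for smooth functions $\kappa,\mu,\nu$ on $M$, if $$R(X,Y)\xi=\kappa\{\eta(Y)X-\eta(X)Y\}+\mu\{\eta(Y)hX-\eta(X)hY\}+\nu\{\eta(Y)\phi hX-\eta(X)\phi hY\}$$ for all vector fields $X,Y$. On an almost contact metric manifold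 define the tensors $$\begin{aligned} R_1(X,Y)Z&=g(Y,Z)X-g(X,Z)Y,\\ R_3(X,Y)Z&=\eta(X)\eta(Z)Y-\eta(Y)\eta(Z)X+g(X,Z)\eta(Y)\xi-g(Y,Z)\eta(X)\xi,\\ R_4(X,Y)Z&=g(Y,Z)hX-g(X,Z)hY+g(hY,Z)X-g(hX,Z)Y,\\ R_7(X,Y)Z&=g(Y,Z)\phi hX-g(X,Z)\phi hY+g(\phi hY,Z)X-g(\phi hX,Z)Y. \end{aligned}$$ Let $(M,\phi,\xi,\eta,g)$ be a 3-dimensional $(\kappa,\mu,\nu)$-contact metric manifold, and let $F:M\to\mathbb R$ be its $\phi$-sectional curvature: $F(p)=g(R(X,\phi X)\phi X,X)$ for a unit vector $X\in T_pM$ orthogonal to $\xi_p$. Let $a>0$ be a constant and let $$\bar\phi=\phi,\qquad \bar\xi=\tfrac1a\xi,\qquad \bar\eta=a\,\eta,\qquad \bar g=a\,g+a(a-1)\,\eta\otimes\eta$$ be the $D_a$-homothetic deformation of the structure. Then the curvature tensor $\bar R$ of $\bar g$ is $$\bar R=\bar f_1\bar R_1+\bar f_3\bar R_3+\bar f_4\bar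 R_4+\bar f_7\bar R_7,$$ where $\bar R_1,\bar R_3,\bar R_4,\bar R_7$ are the tensors above formed from $(\bar\phi,\bar\xi,\bar\eta,\bar g)$ and $\bar h=\frac12L_{\bar\xi}\bar\phi$, and $$\bar f_1=\frac Fa-\frac{(a-1)(3a+1-\kappa)}{a^2},\qquad \bar f_3=\frac Fa+\frac{(a-2)\kappa-4a^2+2a+2}{a^2},\qquad \bar f_4=\frac{\mu+2a-2}{a},\qquad \bar f_7=\frac{\nu}{a}.$$ In particular, the deformed curvature tensor is completely determined by the deformed structure tensors and the original $\kappa,\mu,\nu$ and $F$. -/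

import Mathlib

open scoped Manifold ContDiff Bundle

noncomputable section

namespace ContactMetric

/-- A (not necessarily smooth) vector field on an `n`-dimensional manifold `M`. -/
abbrev VField (n : ℕ) (M : Type*) [TopologicalSpace M]
    [ChartedSpace (EuclideanSpace ℝ (Fin n)) M] : Type _ :=
  Π x : M, TangentSpace (𝓡 n) x

/-- Smoothness (`C^∞`) of a vector field, as a section of the tangent bundle. -/
def IsSmoothVField {n : ℕ} {M : Type*} [TopologicalSpace M]
    [ChartedSpace (EuclideanSpace ℝ (Fin n)) M] [IsManifold (𝓡 n) ∞ M]
    (X : VField n M) : Prop :=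
  ContMDiff (𝓡 n) (𝓡 n).tangent ∞ (fun x => (⟨x, X x⟩ : TangentBundle (𝓡 n) M))

/-- Differentiability of a vector field at a point. -/
def VFieldDiffAt {n : ℕ} {M : Type*} [TopologicalSpace M]
    [ChartedSpace (EuclideanSpace ℝ (Fin n)) M] [IsManifold (𝓡 n) ∞ M]
    (X : VField n M) (p : M) : Prop :=
  MDifferentiableAt (𝓡 n) (𝓡 n).tangent (fun x => (⟨x, X x⟩ : TangentBundle (𝓡 n) M)) p

/-- A smooth Riemannian metric on `M`. -/
abbrev Metric (n : ℕ) (M : Type*) [TopologicalSpace M]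
    [ChartedSpace (EuclideanSpace ℝ (Fin n)) M] [IsManifold (𝓡 n) ∞ M] : Type _ :=
  Bundle.ContMDiffRiemannianMetric (𝓡 n) ∞ (EuclideanSpace ℝ (Fin n))
    (fun x : M => TangentSpace (𝓡 n) x)

section Riemannian

variable {n : ℕ} {M : Type*} [TopologicalSpace M] [ChartedSpace (EuclideanSpace ℝ (Fin n)) M]

/-- The derivative `X f` of a real function `f` along a vector field `X`. -/
def dirDeriv (X : VField n M) (f : M → ℝ) (p : M) : ℝ := mvfderiv (𝓡 n) f p (X p)

/-- The Lie bracket `[X, Y]`. -/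
def bracket (X Y : VField n M) : VField n M := VectorField.mlieBracket (𝓡 n) X Y

variable [IsManifold (𝓡 n) ∞ M]

/-- The right-hand side of the Koszul formula. -/
def koszul (g : Metric n M) (X Y Z : VField n M) (p : M) : ℝ :=
  dirDeriv X (fun x => g.inner x (Y x) (Z x)) p
    + dirDeriv Y (fun x => g.inner x (Z x) (X x)) p
    - dirDeriv Z (fun x => g.inner x (X x) (Y x)) p
    + g.inner p (bracket X Y p) (Z p)
    - g.inner p (bracket X Z p) (Y p)
    - g.inner p (bracket Y Z p) (X p)

/-- `v` is the value at `p` of the Levi-Civita derivative `∇_X Y`. -/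
def IsLeviCivitaValue (g : Metric n M) (X Y : VField n M) (p : M)
    (v : TangentSpace (𝓡 n) p) : Prop :=
  ∀ Z : VField n M, VFieldDiffAt Z p → 2 * g.inner p v (Z p) = koszul g X Y Z p

/-- The Levi-Civita connection `∇_X Y` of `g`: the value at `p` is the unique tangent vector that
satisfies the Koszul formula (existence and uniqueness, for `X` and `Y` differentiable at `p`, is
`existsUnique_isLeviCivitaValue`). -/
def leviCivita (g : Metric n M) (X Y : VField n M) : VField n M :=
  fun p => Classical.epsilon (IsLeviCivitaValue g X Y p)

/-- The curvature `R(X, Y) Z = ∇_X ∇_Y Z - ∇_Y ∇_X Z - ∇_[X, Y] Z` of `g`. -/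
def curvature (g : Metric n M) (X Y Z : VField n M) : VField n M := fun p =>
  leviCivita g X (leviCivita g Y Z) p - leviCivita g Y (leviCivita g X Z) p
    - leviCivita g (bracket X Y) Z p

theorem metric_diffAt (g : Metric n M) {X Y : VField n M} {p : M}
    (hX : VFieldDiffAt X p) (hY : VFieldDiffAt Y p) :
    MDifferentiableAt (𝓡 n) 𝓘(ℝ, ℝ) (fun x => g.inner x (X x) (Y x)) p := by
  have h : MDifferentiableAt (𝓡 n) ((𝓡 n).prod 𝓘(ℝ))
      (fun x => (⟨x, g.inner x (X x) (Y x)⟩ : Bundle.TotalSpace ℝ (Bundle.Trivial M ℝ))) p := by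
    apply MDifferentiableAt.clm_bundle_apply₂ (F₁ := EuclideanSpace ℝ (Fin n))
      (F₂ := EuclideanSpace ℝ (Fin n)) (E₁ := fun x : M => TangentSpace (𝓡 n) x)
      (E₂ := fun x : M => TangentSpace (𝓡 n) x)
    · exact g.contMDiff.mdifferentiableAt (by simp)
    · exact hX
    · exact hY
  exact ((mdifferentiableAt_totalSpace _ _).1 h).2

theorem koszul_tensorialAt (g : Metric n M) {X Y : VField n M} {p : M}
    (hX : VFieldDiffAt X p) (hY : VFieldDiffAt Y p) :
    TensorialAt (𝓡 n) (EuclideanSpace ℝ (Fin n)) (fun Z : VField n M => koszul g X Y Z p) p := by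
  constructor
  · intro f Z hf hZ
    have h1 := metric_diffAt g hY hZ
    have h2 := metric_diffAt g hZ hX
    simp only [koszul, dirDeriv, bracket]
    rw [VectorField.mlieBracket_smul_right hf hZ, VectorField.mlieBracket_smul_right hf hZ]
    have e1 : (fun x => g.inner x (Y x) ((f • Z) x)) = f * fun x => g.inner x (Y x) (Z x) := by
      ext x; simp
    have e2 : (fun x => g.inner x ((f • Z) x) (X x)) = f * fun x => g.inner x (Z x) (X x) := by
      ext x; simp
    rw [e1, e2, mvfderiv_mul hf h1, mvfderiv_mul hf h2]
    simp [g.symm p (Z p)]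
    ring
  · intro Z Z' hZ hZ'
    simp only [koszul, dirDeriv, bracket]
    rw [VectorField.mlieBracket_add_right hZ hZ', VectorField.mlieBracket_add_right hZ hZ']
    have e1 : (fun x => g.inner x (Y x) ((Z + Z') x)) =
        (fun x => g.inner x (Y x) (Z x)) + fun x => g.inner x (Y x) (Z' x) := by
      ext x; simp
    have e2 : (fun x => g.inner x ((Z + Z') x) (X x)) =
        (fun x => g.inner x (Z x) (X x)) + fun x => g.inner x (Z' x) (X x) := by
      ext x; simp
    rw [e1, e2, mvfderiv_add (metric_diffAt g hY hZ) (metric_diffAt g hY hZ'),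
      mvfderiv_add (metric_diffAt g hZ hX) (metric_diffAt g hZ' hX)]
    simp
    ring

theorem existsUnique_isLeviCivitaValue (g : Metric n M) {X Y : VField n M} {p : M}
    (hX : VFieldDiffAt X p) (hY : VFieldDiffAt Y p) :
    ∃! v, IsLeviCivitaValue g X Y p v := by
  have : FiniteDimensional ℝ (TangentSpace (𝓡 n) p) :=
    inferInstanceAs (FiniteDimensional ℝ (EuclideanSpace ℝ (Fin n)))
  let B : TangentSpace (𝓡 n) p →ₗ[ℝ] Module.Dual ℝ (TangentSpace (𝓡 n) p) :=
    { toFun := fun v => (g.inner p v).toLinearMap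
      map_add' := by intro v w; ext; simp
      map_smul' := by intro c v; ext; simp }
  have hinj : Function.Injective B := by
    rw [← LinearMap.ker_eq_bot, LinearMap.ker_eq_bot']
    intro v hv
    by_contra hne
    have h1 := g.pos p v hne
    have h2 : g.inner p v v = 0 := congrArg (fun L => L v) hv
    linarith
  have hsurj : Function.Surjective B :=
    (LinearMap.injective_iff_surjective_of_finrank_eq_finrank
      (Subspace.dual_finrank_eq (K := ℝ)).symm).1 hinj
  have hT := koszul_tensorialAt g hX hY
  obtain ⟨v, hv⟩ := hsurj (((1 / 2 : ℝ) • (TensorialAt.mkHom _ p hT)).toLinearMap)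
  refine ⟨v, ?_, ?_⟩
  · intro Z hZ
    have h1 : g.inner p v (Z p) = (1 / 2 : ℝ) * TensorialAt.mkHom _ p hT (Z p) :=
      congrArg (fun L => L (Z p)) hv
    rw [h1, TensorialAt.mkHom_apply hT hZ]
    ring
  · intro w hw
    apply hinj
    ext u
    have hu : VFieldDiffAt
        (FiberBundle.extend (EuclideanSpace ℝ (Fin n)) (E := fun x : M => TangentSpace (𝓡 n) x) u)
        p := FiberBundle.mdifferentiableAt_extend ..
    have h1 := hw _ hu
    have h2 : g.inner p v u = (1 / 2 : ℝ) * TensorialAt.mkHom _ p hT u :=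
      congrArg (fun L => L u) hv
    have h3 := TensorialAt.mkHom_apply hT hu
    rw [FiberBundle.extend_apply_self] at h1 h3
    change g.inner p w u = g.inner p v u
    rw [h2, h3]
    linarith

end Riemannian

/-- An almost contact metric structure `(φ, ξ, η, g)` on an `n`-dimensional manifold `M`. -/
structure AlmostContactMetric (n : ℕ) (M : Type*) [TopologicalSpace M]
    [ChartedSpace (EuclideanSpace ℝ (Fin n)) M] [IsManifold (𝓡 n) ∞ M] where
  /-- the Riemannian metric -/
  g : Metric n M
  /-- the `(1,1)`-tensor field -/
  φ : Π x : M, TangentSpace (𝓡 n) x →L[ℝ] TangentSpace (𝓡 n) x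
  /-- the structure vector field -/
  ξ : VField n M
  /-- the 1-form -/
  η : Π x : M, TangentSpace (𝓡 n) x →L[ℝ] ℝ
  φ_smooth : ContMDiff (𝓡 n)
    ((𝓡 n).prod 𝓘(ℝ, EuclideanSpace ℝ (Fin n) →L[ℝ] EuclideanSpace ℝ (Fin n))) ∞
    (fun x => Bundle.TotalSpace.mk' (EuclideanSpace ℝ (Fin n) →L[ℝ] EuclideanSpace ℝ (Fin n))
      (E := fun x : M => TangentSpace (𝓡 n) x →L[ℝ] TangentSpace (𝓡 n) x) x (φ x))
  ξ_smooth : IsSmoothVField ξ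
  η_smooth : ContMDiff (𝓡 n) ((𝓡 n).prod 𝓘(ℝ, EuclideanSpace ℝ (Fin n) →L[ℝ] ℝ)) ∞
    (fun x => Bundle.TotalSpace.mk' (EuclideanSpace ℝ (Fin n) →L[ℝ] ℝ)
      (E := fun x : M => TangentSpace (𝓡 n) x →L[ℝ] ℝ) x (η x))
  η_ξ : ∀ x, η x (ξ x) = 1
  φ_φ : ∀ x (u : TangentSpace (𝓡 n) x), φ x (φ x u) = -u + η x u • ξ x
  g_φ_φ : ∀ x (u v : TangentSpace (𝓡 n) x),
    g.inner x (φ x u) (φ x v) = g.inner x u v - η x u * η x v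

namespace AlmostContactMetric

variable {n : ℕ} {M : Type*} [TopologicalSpace M] [ChartedSpace (EuclideanSpace ℝ (Fin n)) M]
  [IsManifold (𝓡 n) ∞ M]

theorem φ_ξ (S : AlmostContactMetric n M) (x : M) : S.φ x (S.ξ x) = 0 := by
  have h0 : S.φ x (S.φ x (S.ξ x)) = 0 := by rw [S.φ_φ, S.η_ξ]; simp
  have h1 : S.φ x (S.φ x (S.φ x (S.ξ x))) = 0 := by rw [h0]; simp
  rw [S.φ_φ] at h1
  have h2 : S.φ x (S.ξ x) = S.η x (S.φ x (S.ξ x)) • S.ξ x := by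
    rw [neg_add_eq_zero] at h1; exact h1
  set c := S.η x (S.φ x (S.ξ x)) with hc
  rw [h2, map_smul, h2, smul_smul] at h0
  have h3 := congrArg (S.η x) h0
  rw [map_smul, S.η_ξ, map_zero] at h3
  have h4 : c = 0 := by simpa using h3
  rw [h2, h4, zero_smul]

theorem η_φ (S : AlmostContactMetric n M) (x : M) (u : TangentSpace (𝓡 n) x) :
    S.η x (S.φ x u) = 0 := by
  have h1 := S.φ_φ x (S.φ x u)
  rw [S.φ_φ x u, map_add, map_neg, map_smul, S.φ_ξ, smul_zero, add_zero] at h1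
  have h2 := congrArg (S.η x) (left_eq_add.1 h1)
  rwa [map_smul, S.η_ξ, map_zero, smul_eq_mul, mul_one] at h2

theorem g_ξ (S : AlmostContactMetric n M) (x : M) (u : TangentSpace (𝓡 n) x) :
    S.g.inner x u (S.ξ x) = S.η x u := by
  have h := S.g_φ_φ x u (S.ξ x)
  rw [S.φ_ξ, S.η_ξ, map_zero] at h
  linarith

theorem g_self_nonneg (S : AlmostContactMetric n M) (x : M) (u : TangentSpace (𝓡 n) x) :
    0 ≤ S.g.inner x u u := by
  by_cases h : u = 0
  · simp [h]
  · exact (S.g.pos x u h).le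

theorem η_sq_le (S : AlmostContactMetric n M) (x : M) (u : TangentSpace (𝓡 n) x) :
    S.η x u * S.η x u ≤ S.g.inner x u u := by
  have h := S.g_φ_φ x u u
  have := S.g_self_nonneg x (S.φ x u)
  linarith

set_option synthInstance.maxHeartbeats 200000 in
theorem deform_smooth (S : AlmostContactMetric n M) (a : ℝ) :
    ContMDiff (𝓡 n) ((𝓡 n).prod 𝓘(ℝ, EuclideanSpace ℝ (Fin n) →L[ℝ]
      EuclideanSpace ℝ (Fin n) →L[ℝ] ℝ)) ∞
    (fun x => Bundle.TotalSpace.mk' (EuclideanSpace ℝ (Fin n) →L[ℝ]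
        EuclideanSpace ℝ (Fin n) →L[ℝ] ℝ)
      (E := fun x : M => TangentSpace (𝓡 n) x →L[ℝ] TangentSpace (𝓡 n) x →L[ℝ] ℝ) x
      (a • S.g.inner x + (a * (a - 1)) • (S.η x).smulRight (S.η x))) := by
  intro x₀
  have hη := ((contMDiffAt_hom_bundle _).1 (S.η_smooth x₀)).2
  have hg := ((contMDiffAt_hom_bundle _).1 (S.g.contMDiff x₀)).2
  rw [contMDiffAt_hom_bundle]
  refine ⟨contMDiffAt_id, ?_⟩
  have h1 : ContDiff ℝ ∞ (fun q : (EuclideanSpace ℝ (Fin n) →L[ℝ] EuclideanSpace ℝ (Fin n) →L[ℝ] ℝ)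
      × (EuclideanSpace ℝ (Fin n) →L[ℝ] ℝ) => a • q.1 + (a * (a - 1)) • q.2.smulRight q.2) :=
    (contDiff_fst.const_smul a).add ((contDiff_snd.smulRight contDiff_snd).const_smul _)
  have h3 := h1.contMDiff.contMDiffAt.comp x₀ (hg.prodMk_space hη)
  refine h3.congr_of_eventuallyEq ?_
  have hb : (trivializationAt (EuclideanSpace ℝ (Fin n))
      (fun x : M => TangentSpace (𝓡 n) x) x₀).baseSet ∈ nhds x₀ :=
    (trivializationAt _ _ x₀).open_baseSet.mem_nhds (FiberBundle.mem_baseSet_trivializationAt' x₀)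
  filter_upwards [hb] with x hx
  ext v w
  have e1 := ContinuousLinearMap.inCoordinates_eq (ϕ := S.η x) hx
    (show x ∈ (trivializationAt ℝ (Bundle.Trivial M ℝ) x₀).baseSet from Set.mem_univ _)
  have e2 := inCoordinates_apply_eq₂ (ϕ := S.g.inner x) (v := v) (w := w) hx hx
    (show x ∈ (trivializationAt ℝ (Bundle.Trivial M ℝ) x₀).baseSet from Set.mem_univ _)
  have e3 := inCoordinates_apply_eq₂
    (ϕ := a • S.g.inner x + (a * (a - 1)) • (S.η x).smulRight (S.η x)) (v := v) (w := w) hx hx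
    (show x ∈ (trivializationAt ℝ (Bundle.Trivial M ℝ) x₀).baseSet from Set.mem_univ _)
  have e4 : (trivializationAt ℝ (Bundle.Trivial M ℝ) x₀).linearMapAt ℝ x = LinearMap.id := by
    ext; simp
  rw [e4] at e2 e3
  refine e3.trans ?_
  simp only [Function.comp_apply, add_apply, smul_apply, ContinuousLinearMap.smulRight_apply]
  rw [e1]
  simp only [LinearMap.id_apply] at e2
  simp
  exact Or.inl e2.symm

theorem deform_lower (S : AlmostContactMetric n M) {a : ℝ} (ha : 0 < a) (x : M)
    (u : TangentSpace (𝓡 n) x) :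
    min a (a * a) * S.g.inner x u u ≤
      a * S.g.inner x u u + a * (a - 1) * (S.η x u * S.η x u) := by
  have h1 := S.η_sq_le x u
  have h2 := mul_self_nonneg (S.η x u)
  have h3 := S.g_self_nonneg x u
  rcases le_total 1 a with h | h
  · have := mul_le_mul_of_nonneg_right (min_le_left a (a * a)) h3
    have : 0 ≤ a * (a - 1) * (S.η x u * S.η x u) := by
      have : 0 ≤ a - 1 := by linarith
      positivity
    linarith
  · have h4 := mul_le_mul_of_nonneg_right (min_le_right a (a * a)) h3
    have h5 : 0 ≤ a * (1 - a) := mul_nonneg ha.le (by linarith)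
    nlinarith [mul_le_mul_of_nonneg_left h1 h5]

/-- The metric `a g + a (a - 1) η ⊗ η`. -/
def deformMetric (S : AlmostContactMetric n M) (a : ℝ) (ha : 0 < a) : Metric n M where
  inner x := a • S.g.inner x + (a * (a - 1)) • (S.η x).smulRight (S.η x)
  symm x v w := by
    simp only [add_apply, smul_apply,
      ContinuousLinearMap.smulRight_apply, smul_eq_mul, S.g.symm x v w]
    ring
  pos x v hv := by
    have h := S.deform_lower ha x v
    have : 0 < min a (a * a) * S.g.inner x v v :=
      mul_pos (lt_min ha (mul_pos ha ha)) (S.g.pos x v hv)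
    simp
    linarith
  isVonNBounded x := by
    have hc : 0 < min a (a * a) := lt_min ha (mul_pos ha ha)
    set c := min a (a * a) with hcdef
    have h1 := (S.g.isVonNBounded x).image
      ((Real.sqrt c)⁻¹ • ContinuousLinearMap.id ℝ (TangentSpace (𝓡 n) x))
    refine h1.subset ?_
    intro v hv
    refine ⟨Real.sqrt c • v, ?_, ?_⟩
    · have h2 := S.deform_lower ha x v
      rw [← hcdef] at h2
      have h3 : Real.sqrt c * Real.sqrt c = c := Real.mul_self_sqrt hc.le
      simp at hv ⊢
      rw [← mul_assoc, h3]
      linarith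
    · have h4 : Real.sqrt c ≠ 0 := (Real.sqrt_pos.2 hc).ne'
      simp [smul_smul, h4]
  contMDiff := S.deform_smooth a

/-- The `D_a`-homothetic deformation `(φ, ξ / a, a η, a g + a (a - 1) η ⊗ η)`. -/
def deform (S : AlmostContactMetric n M) (a : ℝ) (ha : 0 < a) : AlmostContactMetric n M where
  g := S.deformMetric a ha
  φ := S.φ
  ξ := fun x => a⁻¹ • S.ξ x
  η := fun x => a • S.η x
  φ_smooth := S.φ_smooth
  ξ_smooth := ContMDiff.const_smul_section (a := a⁻¹) S.ξ_smooth
  η_smooth := ContMDiff.const_smul_section (a := a) S.η_smooth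
  η_ξ x := by simp [S.η_ξ, ha.ne']
  φ_φ x u := by
    rw [S.φ_φ, smul_smul]
    congr 2
    simp
    field_simp
  g_φ_φ x u v := by
    simp [deformMetric, S.g_φ_φ, S.η_φ]
    ring

/-- The operator `φ` on vector fields. -/
def φv (S : AlmostContactMetric n M) (X : VField n M) : VField n M := fun p => S.φ p (X p)

/-- The operator `h` on vector fields, `2 h = L_ξ φ`, that is
`h X = ([ξ, φ X] - φ [ξ, X]) / 2`. -/
def h (S : AlmostContactMetric n M) (X : VField n M) : VField n M :=
  fun p => (1 / 2 : ℝ) • (bracket S.ξ (S.φv X) p - S.φ p (bracket S.ξ X p))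

/-- Contact metric manifold: `dη = Φ` with `Φ(X, Y) = g(X, φ Y)` and
`dη(X, Y) = (X η(Y) - Y η(X) - η([X, Y])) / 2`. -/
def IsContactMetric (S : AlmostContactMetric n M) : Prop :=
  ∀ X Y : VField n M, IsSmoothVField X → IsSmoothVField Y → ∀ p : M,
    (1 / 2 : ℝ) * (dirDeriv X (fun x => S.η x (Y x)) p - dirDeriv Y (fun x => S.η x (X x)) p
      - S.η p (bracket X Y p)) = S.g.inner p (X p) (S.φ p (Y p))

/-- `(κ, μ, ν)`-contact metric manifold: a contact metric manifold with
`R(X, Y)ξ = κ {η(Y)X - η(X)Y} + μ {η(Y)hX - η(X)hY} + ν {η(Y)φhX - η(X)φhY}` for smooth functions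
`κ`, `μ`, `ν`. -/
structure IsKappaMuNu (S : AlmostContactMetric n M) (κ μ ν : M → ℝ) : Prop where
  contact : S.IsContactMetric
  κ_smooth : ContMDiff (𝓡 n) 𝓘(ℝ, ℝ) ∞ κ
  μ_smooth : ContMDiff (𝓡 n) 𝓘(ℝ, ℝ) ∞ μ
  ν_smooth : ContMDiff (𝓡 n) 𝓘(ℝ, ℝ) ∞ ν
  curvature_ξ : ∀ X Y : VField n M, IsSmoothVField X → IsSmoothVField Y → ∀ p : M,
    curvature S.g X Y S.ξ p =
      κ p • (S.η p (Y p) • X p - S.η p (X p) • Y p)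
      + μ p • (S.η p (Y p) • S.h X p - S.η p (X p) • S.h Y p)
      + ν p • (S.η p (Y p) • S.φ p (S.h X p) - S.η p (X p) • S.φ p (S.h Y p))

/-- `k` is the sectional curvature `K(X, φ X) = g(R(X, φ X)φ X, X)` of some `φ`-section at `p`,
spanned by a unit vector `X_p` orthogonal to `ξ_p` and by `φ X_p`. -/
def IsPhiSectionalCurvatureAt (S : AlmostContactMetric n M) (p : M) (k : ℝ) : Prop :=
  ∃ X : VField n M, IsSmoothVField X ∧ S.g.inner p (X p) (X p) = 1 ∧
    S.g.inner p (X p) (S.ξ p) = 0 ∧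
    k = S.g.inner p (curvature S.g X (S.φv X) (S.φv X) p) (X p)

/-- `R₁(X, Y)Z = g(Y, Z)X - g(X, Z)Y`. -/
def R₁ (S : AlmostContactMetric n M) (X Y Z : VField n M) : VField n M := fun p =>
  S.g.inner p (Y p) (Z p) • X p - S.g.inner p (X p) (Z p) • Y p

/-- `R₃(X, Y)Z = η(X)η(Z)Y - η(Y)η(Z)X + g(X, Z)η(Y)ξ - g(Y, Z)η(X)ξ`. -/
def R₃ (S : AlmostContactMetric n M) (X Y Z : VField n M) : VField n M := fun p =>
  (S.η p (X p) * S.η p (Z p)) • Y p - (S.η p (Y p) * S.η p (Z p)) • X p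
    + (S.g.inner p (X p) (Z p) * S.η p (Y p)) • S.ξ p
    - (S.g.inner p (Y p) (Z p) * S.η p (X p)) • S.ξ p

/-- `R₄(X, Y)Z = g(Y, Z)hX - g(X, Z)hY + g(hY, Z)X - g(hX, Z)Y`. -/
def R₄ (S : AlmostContactMetric n M) (X Y Z : VField n M) : VField n M := fun p =>
  S.g.inner p (Y p) (Z p) • S.h X p - S.g.inner p (X p) (Z p) • S.h Y p
    + S.g.inner p (S.h Y p) (Z p) • X p - S.g.inner p (S.h X p) (Z p) • Y p

/-- `R₇(X, Y)Z = g(Y, Z)φhX - g(X, Z)φhY + g(φhY, Z)X - g(φhX, Z)Y`. -/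
def R₇ (S : AlmostContactMetric n M) (X Y Z : VField n M) : VField n M := fun p =>
  S.g.inner p (Y p) (Z p) • S.φ p (S.h X p) - S.g.inner p (X p) (Z p) • S.φ p (S.h Y p)
    + S.g.inner p (S.φ p (S.h Y p)) (Z p) • X p - S.g.inner p (S.φ p (S.h X p)) (Z p) • Y p

end AlmostContactMetric

end ContactMetric

end

/-! The argument is a moving-frame computation. In a frame (ξ, E, φE) that is orthonormal near p,
the geometry is governed by the structure functions c_ijk = g([e_i, e_j], e_k): by the Koszul
formula the connection coefficients are half of signed sums of them, and `curvCoeff_eq_structCoeff`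
writes the curvature through the c_ijk and their first derivatives. The contact condition forces
c_010 = c_020 = 0 and c_120 = 2, and the Jacobi identity then gives c_022 = -c_011. Five functions
remain: A = c_011, B = c_012, C = c_021, P = c_121, Q = c_122. With s = (B + C)/2, the operator h is
hE = sE - AφE, hφE = -AE - sφE (`inner_h_frame`).

The deformed structure has the adapted frame (ξ/a, cE, cφE) with a c² = 1. This multiplies A, B, C
by 1/a and P, Q by c (`structCoeff_deform`), whereas c_120 = 2 does not scale, the deformed
structure being again contact; this is the source of the inhomogeneous terms. For instance d = g(∇_ξ
E, φE) = (B - C)/2 - 1 becomes (d + 1)/a - 1. Comparing components, the (κ, μ, ν)-condition on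
R(·,·)ξ turns into one of the same shape with κ' = (κ + a² - 1)/a², μ' = (μ + 2a - 2)/a, ν' = ν/a.
The relation κ = 1 - A² - s² turns the φ-sectional curvature F into F' = F/a - (a - 1)(3a + 1 -
κ)/a².

In dimension 3 these data determine the whole curvature tensor: `curvature_eq_of_curvCoeff` gives R
= F R₁ + (F - κ) R₃ + μ R₄ + ν R₇. Applied to the deformed structure with F', κ', μ', ν', it is the
theorem. -/

noncomputable section

namespace ContactMetric

open Filter Topology

/-! ### Calculus of directional derivatives and Lie brackets. -/

section Riemannian

variable {n : ℕ} {M : Type*} [TopologicalSpace M] [ChartedSpace (EuclideanSpace ℝ (Fin n)) M]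

/-- Smoothness of a real function on `M`. -/
abbrev IsSmoothFun (n : ℕ) {M : Type*} [TopologicalSpace M]
    [ChartedSpace (EuclideanSpace ℝ (Fin n)) M] (f : M → ℝ) : Prop :=
  ContMDiff (𝓡 n) 𝓘(ℝ, ℝ) ∞ f

theorem IsSmoothFun.diffAt {f : M → ℝ} (hf : IsSmoothFun n f) (p : M) :
    MDifferentiableAt (𝓡 n) 𝓘(ℝ, ℝ) f p :=
  hf.mdifferentiableAt (by simp)

theorem dirDeriv_congr (X : VField n M) {f f' : M → ℝ} {p : M} (h : f =ᶠ[𝓝 p] f') :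
    dirDeriv X f p = dirDeriv X f' p := by
  simp only [dirDeriv, mvfderiv]
  rw [h.mfderiv_eq, h.self_of_nhds]

theorem dirDeriv_add (X : VField n M) {f f' : M → ℝ} {p : M}
    (hf : MDifferentiableAt (𝓡 n) 𝓘(ℝ, ℝ) f p) (hf' : MDifferentiableAt (𝓡 n) 𝓘(ℝ, ℝ) f' p) :
    dirDeriv X (f + f') p = dirDeriv X f p + dirDeriv X f' p := by
  simp [dirDeriv, mvfderiv_add hf hf']

theorem dirDeriv_mul (X : VField n M) {f f' : M → ℝ} {p : M}
    (hf : MDifferentiableAt (𝓡 n) 𝓘(ℝ, ℝ) f p) (hf' : MDifferentiableAt (𝓡 n) 𝓘(ℝ, ℝ) f' p) :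
    dirDeriv X (f * f') p = f p * dirDeriv X f' p + f' p * dirDeriv X f p := by
  simp [dirDeriv, mvfderiv_mul hf hf']

theorem dirDeriv_const (X : VField n M) (c : ℝ) (p : M) : dirDeriv X (fun _ => c) p = 0 := by
  simp [dirDeriv, mvfderiv_const]

theorem dirDeriv_neg (X : VField n M) (f : M → ℝ) (p : M) :
    dirDeriv X (-f) p = -dirDeriv X f p := by
  simp [dirDeriv, mvfderiv_neg]

theorem dirDeriv_const_mul (X : VField n M) (c : ℝ) {f : M → ℝ} {p : M}
    (hf : MDifferentiableAt (𝓡 n) 𝓘(ℝ, ℝ) f p) :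
    dirDeriv X (fun q => c * f q) p = c * dirDeriv X f p := by
  have h := dirDeriv_mul X (f := fun _ => c) mdifferentiableAt_const hf
  rw [dirDeriv_const, mul_zero, add_zero] at h
  exact h

theorem dirDeriv_eq_of_apply_eq {X X' : VField n M} {p : M} (h : X p = X' p) (f : M → ℝ) :
    dirDeriv X f p = dirDeriv X' f p := by
  simp [dirDeriv, h]

theorem dirDeriv_smul_left (f : M → ℝ) (X : VField n M) (f' : M → ℝ) (p : M) :
    dirDeriv (f • X) f' p = f p * dirDeriv X f' p := by
  simp [dirDeriv]

theorem dirDeriv_const_smul_left (c : ℝ) (X : VField n M) (f' : M → ℝ) (p : M) :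
    dirDeriv (c • X) f' p = c * dirDeriv X f' p := by
  simp [dirDeriv]

theorem dirDeriv_add_left (X Y : VField n M) (f' : M → ℝ) (p : M) :
    dirDeriv (X + Y) f' p = dirDeriv X f' p + dirDeriv Y f' p := by
  simp [dirDeriv]

theorem bracket_swap (X Y : VField n M) (p : M) : bracket X Y p = -bracket Y X p :=
  VectorField.mlieBracket_swap_apply

theorem bracket_congr {X X' Y Y' : VField n M} {p : M} (hX : X =ᶠ[𝓝 p] X') (hY : Y =ᶠ[𝓝 p] Y') :
    bracket X Y p = bracket X' Y' p :=
  hX.mlieBracket_vectorField_eq hY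

variable [IsManifold (𝓡 n) ∞ M]

theorem IsSmoothVField.diffAt {X : VField n M} (hX : IsSmoothVField X) (p : M) :
    VFieldDiffAt X p :=
  hX.mdifferentiableAt (by simp)

theorem IsSmoothVField.add {X Y : VField n M} (hX : IsSmoothVField X) (hY : IsSmoothVField Y) :
    IsSmoothVField (X + Y) :=
  ContMDiff.add_section hX hY

theorem IsSmoothVField.smul {f : M → ℝ} {X : VField n M} (hf : IsSmoothFun n f)
    (hX : IsSmoothVField X) : IsSmoothVField (f • X) :=
  ContMDiff.smul_section hf hX

theorem IsSmoothVField.const_smul (c : ℝ) {X : VField n M} (hX : IsSmoothVField X) :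
    IsSmoothVField (c • X) :=
  ContMDiff.const_smul_section hX

theorem IsSmoothVField.bracket {X Y : VField n M} (hX : IsSmoothVField X)
    (hY : IsSmoothVField Y) : IsSmoothVField (bracket X Y) := by
  have : IsManifold (𝓡 n) (((⊤ : ℕ∞) : WithTop ℕ∞) + 1) M :=
    inferInstanceAs (IsManifold (𝓡 n) ∞ M)
  have : IsManifold (𝓡 n) (minSmoothness ℝ 2) M := by
    rw [minSmoothness_of_isRCLikeNormedField]
    exact IsManifold.of_le (n := ∞) ENat.LEInfty.out
  exact ContDiff.mlieBracket_vectorField (m := ⊤) (n := ⊤) hX hY (by simp)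

theorem IsSmoothVField.dirDeriv {X : VField n M} {f : M → ℝ} (hX : IsSmoothVField X)
    (hf : IsSmoothFun n f) : IsSmoothFun n (dirDeriv X f) := by
  have h1 : ContMDiff (𝓡 n).tangent 𝓘(ℝ, ℝ).tangent ∞ (tangentMap (𝓡 n) 𝓘(ℝ, ℝ) f) :=
    hf.contMDiff_tangentMap (by simp)
  exact (contMDiff_snd_tangentBundle_modelSpace ℝ 𝓘(ℝ, ℝ)).comp (h1.comp hX)

theorem metric_smooth (g : Metric n M) {X Y : VField n M} (hX : IsSmoothVField X)
    (hY : IsSmoothVField Y) : IsSmoothFun n (fun x => g.inner x (X x) (Y x)) := by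
  have h : ContMDiff (𝓡 n) ((𝓡 n).prod 𝓘(ℝ)) ∞
      (fun x => (⟨x, g.inner x (X x) (Y x)⟩ : Bundle.TotalSpace ℝ (Bundle.Trivial M ℝ))) := by
    apply ContMDiff.clm_bundle_apply₂ (F₁ := EuclideanSpace ℝ (Fin n))
      (F₂ := EuclideanSpace ℝ (Fin n)) (E₁ := fun x : M => TangentSpace (𝓡 n) x)
      (E₂ := fun x : M => TangentSpace (𝓡 n) x)
    · exact g.contMDiff
    · exact hX
    · exact hY
  intro x
  exact (Bundle.contMDiffAt_totalSpace.1 (h x)).2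

theorem bracket_smul_right (X : VField n M) {f : M → ℝ} {Y : VField n M} {p : M}
    (hf : MDifferentiableAt (𝓡 n) 𝓘(ℝ, ℝ) f p) (hY : VFieldDiffAt Y p) :
    bracket X (f • Y) p = dirDeriv X f p • Y p + f p • bracket X Y p :=
  VectorField.mlieBracket_smul_right hf hY

theorem bracket_smul_left {f : M → ℝ} {X : VField n M} (Y : VField n M) {p : M}
    (hf : MDifferentiableAt (𝓡 n) 𝓘(ℝ, ℝ) f p) (hX : VFieldDiffAt X p) :
    bracket (f • X) Y p = -dirDeriv Y f p • X p + f p • bracket X Y p :=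
  VectorField.mlieBracket_smul_left hf hX

theorem bracket_add_right (X : VField n M) {Y Y' : VField n M} {p : M}
    (hY : VFieldDiffAt Y p) (hY' : VFieldDiffAt Y' p) :
    bracket X (Y + Y') p = bracket X Y p + bracket X Y' p :=
  VectorField.mlieBracket_add_right hY hY'

theorem bracket_add_left {X X' : VField n M} (Y : VField n M) {p : M}
    (hX : VFieldDiffAt X p) (hX' : VFieldDiffAt X' p) :
    bracket (X + X') Y p = bracket X Y p + bracket X' Y p :=
  VectorField.mlieBracket_add_left hX hX'

theorem bracket_const_smul (c d : ℝ) {X Y : VField n M} {p : M}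
    (hX : VFieldDiffAt X p) (hY : IsSmoothVField Y) :
    bracket (c • X) (d • Y) p = (c * d) • bracket X Y p := by
  have h1 : bracket (c • X) (d • Y) p = c • bracket X (d • Y) p :=
    VectorField.mlieBracket_const_smul_left hX
  have h2 : bracket X (d • Y) p = d • bracket X Y p :=
    VectorField.mlieBracket_const_smul_right (hY.diffAt p)
  rw [h1, h2, smul_smul]

/-- The Jacobi identity. -/
theorem bracket_jacobi {X Y Z : VField n M} (hX : IsSmoothVField X) (hY : IsSmoothVField Y)
    (hZ : IsSmoothVField Z) (p : M) :
    bracket X (bracket Y Z) p = bracket (bracket X Y) Z p + bracket Y (bracket X Z) p := by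
  have h2 : minSmoothness ℝ 2 ≤ (∞ : WithTop ℕ∞) := by
    rw [minSmoothness_of_isRCLikeNormedField]; exact ENat.LEInfty.out
  have : IsManifold (𝓡 n) (minSmoothness ℝ 3) M := by
    rw [minSmoothness_of_isRCLikeNormedField]
    exact IsManifold.of_le (n := ∞) ENat.LEInfty.out
  exact VectorField.leibniz_identity_mlieBracket_apply ((hX p).of_le h2) ((hY p).of_le h2)
    ((hZ p).of_le h2)

/-- Subtracting f times the Jacobi identity for X, Y, Z from the one for X, Y, fZ leaves (XYf - YXf
- [X, Y]f) Z = 0 at p. The auxiliary field Z only has to be nonzero there. -/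
theorem dirDeriv_bracket {X Y Z : VField n M} {f : M → ℝ} (hX : IsSmoothVField X)
    (hY : IsSmoothVField Y) (hZ : IsSmoothVField Z) (hf : IsSmoothFun n f) {p : M}
    (hp : Z p ≠ 0) :
    dirDeriv (bracket X Y) f p = dirDeriv X (dirDeriv Y f) p - dirDeriv Y (dirDeriv X f) p := by
  have key : ∀ {X Y : VField n M}, IsSmoothVField X → IsSmoothVField Y →
      bracket X (bracket Y (f • Z)) p =
        dirDeriv X (dirDeriv Y f) p • Z p + dirDeriv Y f p • bracket X Z p
          + (dirDeriv X f p • bracket Y Z p + f p • bracket X (bracket Y Z) p) := by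
    intro X Y hX hY
    have e : bracket Y (f • Z) = dirDeriv Y f • Z + f • bracket Y Z := by
      funext q
      exact bracket_smul_right Y (hf.diffAt q) (hZ.diffAt q)
    rw [e, bracket_add_right X ((hZ.smul (hY.dirDeriv hf)).diffAt p)
      (((hY.bracket hZ).smul hf).diffAt p),
      bracket_smul_right X ((hY.dirDeriv hf).diffAt p) (hZ.diffAt p),
      bracket_smul_right X (hf.diffAt p) ((hY.bracket hZ).diffAt p)]
  have h1 := bracket_jacobi hX hY (hZ.smul hf) p
  rw [key hX hY, key hY hX, bracket_smul_right _ (hf.diffAt p) (hZ.diffAt p),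
    bracket_jacobi hX hY hZ p] at h1
  have h2 : (dirDeriv X (dirDeriv Y f) p - dirDeriv Y (dirDeriv X f) p
      - dirDeriv (bracket X Y) f p) • Z p = 0 := by
    rw [sub_smul, sub_smul]
    linear_combination (norm := module) h1
  rcases smul_eq_zero.1 h2 with h | h
  · linarith
  · exact absurd h hp

end Riemannian

/-! ### Levi-Civita connection and tensoriality of the curvature. -/

section LeviCivita

variable {n : ℕ} {M : Type*} [TopologicalSpace M] [ChartedSpace (EuclideanSpace ℝ (Fin n)) M]
  [IsManifold (𝓡 n) ∞ M] (g : Metric n M)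

theorem leviCivita_spec {X Y : VField n M} {p : M} (hX : VFieldDiffAt X p)
    (hY : VFieldDiffAt Y p) : IsLeviCivitaValue g X Y p (leviCivita g X Y p) :=
  Classical.epsilon_spec (existsUnique_isLeviCivitaValue g hX hY).exists

theorem leviCivita_eq {X Y : VField n M} {p : M} (hX : VFieldDiffAt X p)
    (hY : VFieldDiffAt Y p) {v : TangentSpace (𝓡 n) p} (hv : IsLeviCivitaValue g X Y p v) :
    leviCivita g X Y p = v :=
  (existsUnique_isLeviCivitaValue g hX hY).unique (leviCivita_spec g hX hY) hv

/-- The Koszul expression sees only the germs of the fields at p. Locality is needed because the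
frames below are globally defined but orthonormal only near a point. -/
theorem leviCivita_congr {X X' Y Y' : VField n M} {p : M} (hX : X =ᶠ[𝓝 p] X')
    (hY : Y =ᶠ[𝓝 p] Y') : leviCivita g X Y p = leviCivita g X' Y' p := by
  have h : ∀ Z : VField n M, koszul g X Y Z p = koszul g X' Y' Z p := by
    intro Z
    have e1 : (fun x => g.inner x (Y x) (Z x)) =ᶠ[𝓝 p] fun x => g.inner x (Y' x) (Z x) := by
      filter_upwards [hY] with x hx; rw [hx]
    have e2 : (fun x => g.inner x (Z x) (X x)) =ᶠ[𝓝 p] fun x => g.inner x (Z x) (X' x) := by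
      filter_upwards [hX] with x hx; rw [hx]
    have e3 : (fun x => g.inner x (X x) (Y x)) =ᶠ[𝓝 p] fun x => g.inner x (X' x) (Y' x) := by
      filter_upwards [hX, hY] with x hx hx'; rw [hx, hx']
    simp only [koszul]
    rw [dirDeriv_congr _ e1, dirDeriv_congr _ e2, dirDeriv_congr _ e3, bracket_congr hX hY,
      bracket_congr hX (EventuallyEq.refl _ Z), bracket_congr hY (EventuallyEq.refl _ Z),
      dirDeriv_eq_of_apply_eq hX.self_of_nhds, dirDeriv_eq_of_apply_eq hY.self_of_nhds,
      hX.self_of_nhds, hY.self_of_nhds]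
  have : IsLeviCivitaValue g X Y p = IsLeviCivitaValue g X' Y' p := by
    funext v
    simp only [IsLeviCivitaValue, h]
  rw [leviCivita, leviCivita, this]

theorem leviCivita_eventuallyEq {X X' Y Y' : VField n M} {p : M} (hX : X =ᶠ[𝓝 p] X')
    (hY : Y =ᶠ[𝓝 p] Y') : leviCivita g X Y =ᶠ[𝓝 p] leviCivita g X' Y' := by
  filter_upwards [hX.eventuallyEq_nhds, hY.eventuallyEq_nhds] with q h1 h2
  exact leviCivita_congr g h1 h2

theorem inner_smul_field_left (f : M → ℝ) (X Y : VField n M) :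
    (fun x => g.inner x ((f • X) x) (Y x)) = f * fun x => g.inner x (X x) (Y x) := by
  ext x; simp

theorem inner_smul_field_right (f : M → ℝ) (X Y : VField n M) :
    (fun x => g.inner x (X x) ((f • Y) x)) = f * fun x => g.inner x (X x) (Y x) := by
  ext x; simp

theorem inner_add_field_left (X X' Y : VField n M) :
    (fun x => g.inner x ((X + X') x) (Y x)) =
      (fun x => g.inner x (X x) (Y x)) + fun x => g.inner x (X' x) (Y x) := by
  ext x; simp

theorem inner_add_field_right (X Y Y' : VField n M) :
    (fun x => g.inner x (X x) ((Y + Y') x)) =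
      (fun x => g.inner x (X x) (Y x)) + fun x => g.inner x (X x) (Y' x) := by
  ext x; simp

theorem leviCivita_smul_left {f : M → ℝ} {X Y : VField n M} (hf : IsSmoothFun n f)
    (hX : IsSmoothVField X) (hY : IsSmoothVField Y) (p : M) :
    leviCivita g (f • X) Y p = f p • leviCivita g X Y p := by
  refine leviCivita_eq g ((hX.smul hf).diffAt p) (hY.diffAt p) fun Z hZ => ?_
  have h := leviCivita_spec g (hX.diffAt p) (hY.diffAt p) Z hZ
  simp only [koszul] at h ⊢
  rw [inner_smul_field_right, inner_smul_field_left, dirDeriv_smul_left,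
    dirDeriv_mul _ (hf.diffAt p) (metric_diffAt g hZ (hX.diffAt p)),
    dirDeriv_mul _ (hf.diffAt p) (metric_diffAt g (hX.diffAt p) (hY.diffAt p)),
    bracket_smul_left _ (hf.diffAt p) (hX.diffAt p),
    bracket_smul_left _ (hf.diffAt p) (hX.diffAt p)]
  simp
  rw [g.symm p (Z p) (X p)]
  linear_combination f p * h

theorem leviCivita_add_left {X X' Y : VField n M}
    (hX : IsSmoothVField X) (hX' : IsSmoothVField X') (hY : IsSmoothVField Y) (p : M) :
    leviCivita g (X + X') Y p = leviCivita g X Y p + leviCivita g X' Y p := by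
  refine leviCivita_eq g ((hX.add hX').diffAt p) (hY.diffAt p) fun Z hZ => ?_
  have h := leviCivita_spec g (hX.diffAt p) (hY.diffAt p) Z hZ
  have h' := leviCivita_spec g (hX'.diffAt p) (hY.diffAt p) Z hZ
  simp only [koszul] at h h' ⊢
  rw [inner_add_field_right, inner_add_field_left, dirDeriv_add_left,
    dirDeriv_add _ (metric_diffAt g hZ (hX.diffAt p)) (metric_diffAt g hZ (hX'.diffAt p)),
    dirDeriv_add _ (metric_diffAt g (hX.diffAt p) (hY.diffAt p))
      (metric_diffAt g (hX'.diffAt p) (hY.diffAt p)),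
    bracket_add_left _ (hX.diffAt p) (hX'.diffAt p),
    bracket_add_left _ (hX.diffAt p) (hX'.diffAt p)]
  simp
  linear_combination h + h'

theorem leviCivita_smul_right {f : M → ℝ} {X Y : VField n M} (hf : IsSmoothFun n f)
    (hX : IsSmoothVField X) (hY : IsSmoothVField Y) (p : M) :
    leviCivita g X (f • Y) p = dirDeriv X f p • Y p + f p • leviCivita g X Y p := by
  refine leviCivita_eq g (hX.diffAt p) ((hY.smul hf).diffAt p) fun Z hZ => ?_
  have h := leviCivita_spec g (hX.diffAt p) (hY.diffAt p) Z hZ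
  simp only [koszul] at h ⊢
  rw [inner_smul_field_right, inner_smul_field_left, dirDeriv_smul_left,
    dirDeriv_mul _ (hf.diffAt p) (metric_diffAt g (hY.diffAt p) hZ),
    dirDeriv_mul _ (hf.diffAt p) (metric_diffAt g (hX.diffAt p) (hY.diffAt p)),
    bracket_smul_left _ (hf.diffAt p) (hY.diffAt p),
    bracket_smul_right _ (hf.diffAt p) (hY.diffAt p)]
  simp
  rw [g.symm p (X p) (Y p)]
  linear_combination f p * h

theorem leviCivita_add_right {X Y Y' : VField n M}
    (hX : IsSmoothVField X) (hY : IsSmoothVField Y) (hY' : IsSmoothVField Y') (p : M) :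
    leviCivita g X (Y + Y') p = leviCivita g X Y p + leviCivita g X Y' p := by
  refine leviCivita_eq g (hX.diffAt p) ((hY.add hY').diffAt p) fun Z hZ => ?_
  have h := leviCivita_spec g (hX.diffAt p) (hY.diffAt p) Z hZ
  have h' := leviCivita_spec g (hX.diffAt p) (hY'.diffAt p) Z hZ
  simp only [koszul] at h h' ⊢
  rw [inner_add_field_right, inner_add_field_left, dirDeriv_add_left,
    dirDeriv_add _ (metric_diffAt g (hY.diffAt p) hZ) (metric_diffAt g (hY'.diffAt p) hZ),
    dirDeriv_add _ (metric_diffAt g (hX.diffAt p) (hY.diffAt p))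
      (metric_diffAt g (hX.diffAt p) (hY'.diffAt p)),
    bracket_add_right _ (hY.diffAt p) (hY'.diffAt p),
    bracket_add_left _ (hY.diffAt p) (hY'.diffAt p)]
  simp
  linear_combination h + h'

/-- The Levi-Civita connection preserves smoothness of vector fields. -/
def PreservesSmooth (g : Metric n M) : Prop :=
  ∀ X Y : VField n M, IsSmoothVField X → IsSmoothVField Y → IsSmoothVField (leviCivita g X Y)

theorem curvature_congr {X X' Y Y' Z Z' : VField n M} {p : M} (hX : X =ᶠ[𝓝 p] X')
    (hY : Y =ᶠ[𝓝 p] Y') (hZ : Z =ᶠ[𝓝 p] Z') :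
    curvature g X Y Z p = curvature g X' Y' Z' p := by
  simp only [curvature]
  rw [leviCivita_congr g hX (leviCivita_eventuallyEq g hY hZ),
    leviCivita_congr g hY (leviCivita_eventuallyEq g hX hZ),
    leviCivita_congr g (X := bracket X Y) (X' := bracket X' Y') _ hZ]
  filter_upwards [hX.eventuallyEq_nhds, hY.eventuallyEq_nhds] with q h1 h2
  exact bracket_congr h1 h2

theorem curvature_swap {X Y Z : VField n M} (hX : IsSmoothVField X) (hY : IsSmoothVField Y)
    (hZ : IsSmoothVField Z) (p : M) : curvature g X Y Z p = -curvature g Y X Z p := by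
  have h1 : bracket X Y = (fun _ : M => (-1 : ℝ)) • bracket Y X := by
    funext q
    rw [bracket_swap]
    simp
  have h2 := leviCivita_smul_left g (f := fun _ : M => (-1 : ℝ)) contMDiff_const
    (hY.bracket hX) hZ p
  simp only [curvature]
  rw [h1, h2]
  module

variable {g}

/-- The term (Yf)∇_X Z produced by ∇_Y(f∇_X Z) cancels against the one coming from [fX, Y] = f[X, Y]
- (Yf)X. -/
theorem curvature_smul_left (hg : PreservesSmooth g) {f : M → ℝ} {X Y Z : VField n M}
    (hf : IsSmoothFun n f) (hX : IsSmoothVField X) (hY : IsSmoothVField Y)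
    (hZ : IsSmoothVField Z) (p : M) :
    curvature g (f • X) Y Z p = f p • curvature g X Y Z p := by
  have e1 : leviCivita g (f • X) Z = f • leviCivita g X Z :=
    funext fun q => leviCivita_smul_left g hf hX hZ q
  have hYf : IsSmoothFun n (-dirDeriv Y f) := (hY.dirDeriv hf).neg
  have e2 : bracket (f • X) Y = (-dirDeriv Y f) • X + f • bracket X Y :=
    funext fun q => bracket_smul_left Y (hf.diffAt q) (hX.diffAt q)
  simp only [curvature]
  rw [e1, e2, leviCivita_smul_left g hf hX (hg _ _ hY hZ),
    leviCivita_smul_right g hf hY (hg _ _ hX hZ),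
    leviCivita_add_left g (hX.smul hYf) ((hX.bracket hY).smul hf) hZ,
    leviCivita_smul_left g hYf hX hZ, leviCivita_smul_left g hf (hX.bracket hY) hZ, Pi.neg_apply]
  module

theorem curvature_add_left (hg : PreservesSmooth g) {X X' Y Z : VField n M}
    (hX : IsSmoothVField X) (hX' : IsSmoothVField X') (hY : IsSmoothVField Y)
    (hZ : IsSmoothVField Z) (p : M) :
    curvature g (X + X') Y Z p = curvature g X Y Z p + curvature g X' Y Z p := by
  have e1 : leviCivita g (X + X') Z = leviCivita g X Z + leviCivita g X' Z :=
    funext fun q => leviCivita_add_left g hX hX' hZ q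
  have e2 : bracket (X + X') Y = bracket X Y + bracket X' Y :=
    funext fun q => bracket_add_left Y (hX.diffAt q) (hX'.diffAt q)
  simp only [curvature]
  rw [e1, e2, leviCivita_add_left g hX hX' (hg _ _ hY hZ),
    leviCivita_add_right g hY (hg _ _ hX hZ) (hg _ _ hX' hZ),
    leviCivita_add_left g (hX.bracket hY) (hX'.bracket hY) hZ]
  module

theorem curvature_smul_middle (hg : PreservesSmooth g) {f : M → ℝ} {X Y Z : VField n M}
    (hf : IsSmoothFun n f) (hX : IsSmoothVField X) (hY : IsSmoothVField Y)
    (hZ : IsSmoothVField Z) (p : M) :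
    curvature g X (f • Y) Z p = f p • curvature g X Y Z p := by
  rw [curvature_swap g hX (hY.smul hf) hZ, curvature_smul_left hg hf hY hX hZ,
    curvature_swap g hY hX hZ]
  module

theorem curvature_add_middle (hg : PreservesSmooth g) {X Y Y' Z : VField n M}
    (hX : IsSmoothVField X) (hY : IsSmoothVField Y) (hY' : IsSmoothVField Y')
    (hZ : IsSmoothVField Z) (p : M) :
    curvature g X (Y + Y') Z p = curvature g X Y Z p + curvature g X Y' Z p := by
  rw [curvature_swap g hX (hY.add hY') hZ, curvature_add_left hg hY hY' hX hZ,
    curvature_swap g hY hX hZ, curvature_swap g hY' hX hZ]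
  module

theorem curvature_add_right (hg : PreservesSmooth g) {X Y Z Z' : VField n M}
    (hX : IsSmoothVField X) (hY : IsSmoothVField Y) (hZ : IsSmoothVField Z)
    (hZ' : IsSmoothVField Z') (p : M) :
    curvature g X Y (Z + Z') p = curvature g X Y Z p + curvature g X Y Z' p := by
  have e : ∀ {X : VField n M}, IsSmoothVField X →
      leviCivita g X (Z + Z') = leviCivita g X Z + leviCivita g X Z' := fun hX =>
    funext fun q => leviCivita_add_right g hX hZ hZ' q
  simp only [curvature]
  rw [e hX, e hY, leviCivita_add_right g hX (hg _ _ hY hZ) (hg _ _ hY hZ'),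
    leviCivita_add_right g hY (hg _ _ hX hZ) (hg _ _ hX hZ'),
    leviCivita_add_right g (hX.bracket hY) hZ hZ']
  module

/-- The mixed first-order terms cancel by symmetry, and the second derivatives of f cancel by
`dirDeriv_bracket`, which is what the nonvanishing field W serves. -/
theorem curvature_smul_right (hg : PreservesSmooth g) {f : M → ℝ} {X Y Z W : VField n M}
    (hf : IsSmoothFun n f) (hX : IsSmoothVField X) (hY : IsSmoothVField Y)
    (hZ : IsSmoothVField Z) (hW : IsSmoothVField W) {p : M} (hp : W p ≠ 0) :
    curvature g X Y (f • Z) p = f p • curvature g X Y Z p := by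
  have e : ∀ {X : VField n M}, IsSmoothVField X →
      leviCivita g X (f • Z) = dirDeriv X f • Z + f • leviCivita g X Z := fun hX =>
    funext fun q => leviCivita_smul_right g hf hX hZ q
  have key : ∀ {X Y : VField n M}, IsSmoothVField X → IsSmoothVField Y →
      leviCivita g X (leviCivita g Y (f • Z)) p = dirDeriv X (dirDeriv Y f) p • Z p
        + dirDeriv Y f p • leviCivita g X Z p + (dirDeriv X f p • leviCivita g Y Z p
        + f p • leviCivita g X (leviCivita g Y Z) p) := by
    intro X Y hX hY
    rw [e hY, leviCivita_add_right g hX (hZ.smul (hY.dirDeriv hf)) ((hg _ _ hY hZ).smul hf),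
      leviCivita_smul_right g (hY.dirDeriv hf) hX hZ,
      leviCivita_smul_right g hf hX (hg _ _ hY hZ)]
  simp only [curvature]
  rw [key hX hY, key hY hX, leviCivita_smul_right g hf (hX.bracket hY) hZ,
    dirDeriv_bracket hX hY hW hf hp]
  module

end LeviCivita

theorem sum_smul_apply {n : ℕ} {M : Type*} [TopologicalSpace M]
    [ChartedSpace (EuclideanSpace ℝ (Fin n)) M] {ι : Type*} (s : Finset ι) (f : ι → M → ℝ) (X : ι → VField n M) (q : M) :
    (∑ i ∈ s, f i • X i) q = ∑ i ∈ s, f i q • X i q := by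
  simp [Finset.sum_apply]

/-! ### Orthonormal frames and curvature components. -/

section Frame

variable {n : ℕ} {M : Type*} [TopologicalSpace M] [ChartedSpace (EuclideanSpace ℝ (Fin n)) M]
  [IsManifold (𝓡 n) ∞ M]

/-- Smooth vector fields that are orthonormal at the point `q`. -/
def OrthonormalAt (g : Metric n M) (e : Fin n → VField n M) (q : M) : Prop :=
  ∀ i j, g.inner q (e i q) (e j q) = if i = j then 1 else 0

/-- Global smooth vector fields that are orthonormal near the point `p`. -/
structure IsOrthonormalFrameAt (g : Metric n M) (e : Fin n → VField n M) (p : M) : Prop where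
  smooth : ∀ i, IsSmoothVField (e i)
  ortho : ∀ᶠ q in 𝓝 p, OrthonormalAt g e q

theorem OrthonormalAt.sum_inner_smul {g : Metric n M} {e : Fin n → VField n M} {q : M}
    (h : OrthonormalAt g e q) (v : TangentSpace (𝓡 n) q) :
    ∑ i, g.inner q v (e i q) • e i q = v := by
  have hli : LinearIndependent ℝ (fun i => e i q) := by
    rw [Fintype.linearIndependent_iff]
    intro c hc j
    have h1 := congrArg (fun u => g.inner q u (e j q)) hc
    simpa [h _ _] using h1
  have : FiniteDimensional ℝ (TangentSpace (𝓡 n) q) :=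
    inferInstanceAs (FiniteDimensional ℝ (EuclideanSpace ℝ (Fin n)))
  have hspan := hli.span_eq_top_of_card_eq_finrank' (by
    rw [Fintype.card_fin]
    exact (finrank_euclideanSpace_fin (𝕜 := ℝ) (n := n)).symm)
  obtain ⟨c, rfl⟩ := (Submodule.mem_span_range_iff_exists_fun ℝ).1
    (hspan ▸ Submodule.mem_top : v ∈ Submodule.span ℝ (Set.range fun i => e i q))
  refine Finset.sum_congr rfl fun i _ => ?_
  simp [h _ _]

theorem OrthonormalAt.ext {g : Metric n M} {e : Fin n → VField n M} {q : M}
    (h : OrthonormalAt g e q) {v w : TangentSpace (𝓡 n) q}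
    (hvw : ∀ i, g.inner q v (e i q) = g.inner q w (e i q)) : v = w := by
  rw [← h.sum_inner_smul v, ← h.sum_inner_smul w]
  exact Finset.sum_congr rfl fun i _ => by rw [hvw i]

theorem IsSmoothVField.zero : IsSmoothVField (0 : VField n M) :=
  Bundle.contMDiff_zeroSection ℝ (fun x : M => TangentSpace (𝓡 n) x)

theorem IsSmoothVField.sum {ι : Type*} (s : Finset ι) {X : ι → VField n M}
    (hX : ∀ i, IsSmoothVField (X i)) : IsSmoothVField (∑ i ∈ s, X i) := by
  classical
  induction s using Finset.induction_on with
  | empty => simpa using IsSmoothVField.zero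
  | insert i s hi ih => rw [Finset.sum_insert hi]; exact (hX i).add ih

namespace IsOrthonormalFrameAt

variable {g : Metric n M} {e : Fin n → VField n M} {p : M}

theorem orthonormalAt (he : IsOrthonormalFrameAt g e p) : OrthonormalAt g e p :=
  he.ortho.self_of_nhds

theorem eventuallyEq_sum (he : IsOrthonormalFrameAt g e p) (X : VField n M) :
    X =ᶠ[𝓝 p] (∑ i, (fun q => g.inner q (X q) (e i q)) • e i : VField n M) := by
  filter_upwards [he.ortho] with q hq
  exact ((sum_smul_apply _ _ _ q).trans (hq.sum_inner_smul (X q))).symm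

/-- Expansion in a frame of a local operator that is linear over the smooth functions. -/
theorem expand (he : IsOrthonormalFrameAt g e p) {V : Type*} [AddCommGroup V] [Module ℝ V]
    (T : VField n M → V)
    (hcongr : ∀ X X' : VField n M, X =ᶠ[𝓝 p] X' → T X = T X')
    (hadd : ∀ X X' : VField n M, IsSmoothVField X → IsSmoothVField X' → T (X + X') = T X + T X')
    (hsmul : ∀ (f : M → ℝ) (X : VField n M), IsSmoothFun n f → IsSmoothVField X →
      T (f • X) = f p • T X)
    {X : VField n M} (hX : IsSmoothVField X) :
    T X = ∑ i, g.inner p (X p) (e i p) • T (e i) := by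
  classical
  have hf : ∀ i, IsSmoothFun n (fun q => g.inner q (X q) (e i q)) := fun i =>
    metric_smooth g hX (he.smooth i)
  have h0 : T 0 = 0 := by
    have := hsmul (fun _ => 0) 0 contMDiff_const IsSmoothVField.zero
    rwa [smul_zero, zero_smul] at this
  rw [hcongr _ _ (he.eventuallyEq_sum X)]
  induction (Finset.univ : Finset (Fin n)) using Finset.induction_on with
  | empty => simpa using h0
  | insert i s hi ih =>
    rw [Finset.sum_insert hi, Finset.sum_insert hi,
      hadd _ _ ((he.smooth i).smul (hf i))
        (IsSmoothVField.sum s fun j => (he.smooth j).smul (hf j)),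
      hsmul _ _ (hf i) (he.smooth i), ih]

end IsOrthonormalFrameAt

theorem koszul_smooth (g : Metric n M) {X Y Z : VField n M} (hX : IsSmoothVField X)
    (hY : IsSmoothVField Y) (hZ : IsSmoothVField Z) : IsSmoothFun n (koszul g X Y Z) := by
  unfold koszul
  exact (((((hX.dirDeriv (metric_smooth g hY hZ)).add (hY.dirDeriv (metric_smooth g hZ hX))).sub
    (hZ.dirDeriv (metric_smooth g hX hY))).add (metric_smooth g (hX.bracket hY) hZ)).sub
    (metric_smooth g (hX.bracket hZ) hY)).sub (metric_smooth g (hY.bracket hZ) hX)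

/-- The connection is chosen pointwise, so smoothness is not built in. Its components in a smooth
frame are half the Koszul expression, hence smooth, and smoothness is a local property. -/
theorem preservesSmooth_of_frames {g : Metric n M}
    (h : ∀ p, ∃ e : Fin n → VField n M, IsOrthonormalFrameAt g e p) : PreservesSmooth g := by
  intro X Y hX hY p
  obtain ⟨e, he⟩ := h p
  have hk : ∀ i, (fun q => g.inner q (leviCivita g X Y q) (e i q)) =
      fun q => (1 / 2 : ℝ) * koszul g X Y (e i) q := by
    intro i
    funext q
    have := leviCivita_spec g (hX.diffAt q) (hY.diffAt q) (e i) ((he.smooth i).diffAt q)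
    linarith
  have hs : IsSmoothVField (∑ i, (fun q => g.inner q (leviCivita g X Y q) (e i q)) • e i) := by
    refine IsSmoothVField.sum _ fun i => (he.smooth i).smul ?_
    rw [hk i]
    exact contMDiff_const.mul (koszul_smooth g hX hY (he.smooth i))
  refine (hs p).congr_of_eventuallyEq ?_
  filter_upwards [he.eventuallyEq_sum (leviCivita g X Y)] with q hq
  exact congrArg (Bundle.TotalSpace.mk q) hq

/-- The connection coefficients `g(∇_{e_i} e_j, e_k)`. -/
def connCoeff (g : Metric n M) (e : Fin n → VField n M) (i j k : Fin n) (q : M) : ℝ :=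
  g.inner q (leviCivita g (e i) (e j) q) (e k q)

/-- The structure functions `g([e_i, e_j], e_k)`. -/
def structCoeff (g : Metric n M) (e : Fin n → VField n M) (i j k : Fin n) (q : M) : ℝ :=
  g.inner q (bracket (e i) (e j) q) (e k q)

/-- The curvature components `g(R(e_i, e_j) e_k, e_l)`. -/
def curvCoeff (g : Metric n M) (e : Fin n → VField n M) (i j k l : Fin n) (q : M) : ℝ :=
  g.inner q (curvature g (e i) (e j) (e k) q) (e l q)

namespace IsOrthonormalFrameAt

variable {g : Metric n M} {e : Fin n → VField n M} {p : M}

theorem structCoeff_smooth (he : IsOrthonormalFrameAt g e p) (i j k : Fin n) :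
    IsSmoothFun n (structCoeff g e i j k) :=
  metric_smooth g ((he.smooth i).bracket (he.smooth j)) (he.smooth k)

theorem connCoeff_smooth (he : IsOrthonormalFrameAt g e p) (hg : PreservesSmooth g)
    (i j k : Fin n) : IsSmoothFun n (connCoeff g e i j k) :=
  metric_smooth g (hg _ _ (he.smooth i) (he.smooth j)) (he.smooth k)

theorem dirDeriv_inner_eq_zero (he : IsOrthonormalFrameAt g e p) (X : VField n M) (i j : Fin n) :
    dirDeriv X (fun q => g.inner q (e i q) (e j q)) p = 0 := by
  have h : (fun q => g.inner q (e i q) (e j q)) =ᶠ[𝓝 p] fun _ => if i = j then (1 : ℝ) else 0 := by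
    filter_upwards [he.ortho] with q hq using hq i j
  rw [dirDeriv_congr X h, dirDeriv_const]

theorem connCoeff_eq (he : IsOrthonormalFrameAt g e p) (i j k : Fin n) :
    connCoeff g e i j k p = (structCoeff g e i j k p - structCoeff g e i k j p
      - structCoeff g e j k i p) / 2 := by
  have h := leviCivita_spec g ((he.smooth i).diffAt p) ((he.smooth j).diffAt p) (e k)
    ((he.smooth k).diffAt p)
  simp only [koszul, he.dirDeriv_inner_eq_zero] at h
  simp only [connCoeff, structCoeff]
  linarith

theorem eventually (he : IsOrthonormalFrameAt g e p) :
    ∀ᶠ q in 𝓝 p, IsOrthonormalFrameAt g e q := by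
  filter_upwards [he.ortho.eventually_nhds] with q hq using ⟨he.smooth, hq⟩

theorem leviCivita_sum (he : IsOrthonormalFrameAt g e p) {f : Fin n → M → ℝ}
    (hf : ∀ i, IsSmoothFun n (f i)) {X : VField n M} (hX : IsSmoothVField X)
    (s : Finset (Fin n)) :
    leviCivita g X (∑ i ∈ s, f i • e i) p =
      ∑ i ∈ s, (dirDeriv X (f i) p • e i p + f i p • leviCivita g X (e i) p) := by
  classical
  induction s using Finset.induction_on with
  | empty =>
    have := leviCivita_smul_right g (f := fun _ => 0) contMDiff_const hX
      (IsSmoothVField.zero (n := n) (M := M)) p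
    rw [smul_zero, zero_smul, dirDeriv_const, zero_smul, zero_add] at this
    simpa using this
  | insert i s hi ih =>
    rw [Finset.sum_insert hi, Finset.sum_insert hi, leviCivita_add_right g hX
      ((he.smooth i).smul (hf i)) (IsSmoothVField.sum s fun j => (he.smooth j).smul (hf j)),
      leviCivita_smul_right g (hf i) hX (he.smooth i), ih]

theorem inner_leviCivita_leviCivita (he : IsOrthonormalFrameAt g e p) (hg : PreservesSmooth g)
    (i j k l : Fin n) :
    g.inner p (leviCivita g (e i) (leviCivita g (e j) (e k)) p) (e l p) =
      dirDeriv (e i) (connCoeff g e j k l) p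
        + ∑ m, connCoeff g e j k m p * connCoeff g e i m l p := by
  have h1 := leviCivita_congr g (EventuallyEq.refl (𝓝 p) (e i))
    (he.eventuallyEq_sum (leviCivita g (e j) (e k)))
  rw [h1.trans (he.leviCivita_sum (fun m => he.connCoeff_smooth hg j k m) (he.smooth i) _)]
  simp [Finset.sum_add_distrib, he.orthonormalAt _ _]
  rfl

theorem inner_leviCivita_left (he : IsOrthonormalFrameAt g e p) {X : VField n M}
    (hX : IsSmoothVField X) (k l : Fin n) :
    g.inner p (leviCivita g X (e k) p) (e l p) =
      ∑ m, g.inner p (X p) (e m p) * connCoeff g e m k l p := by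
  have h := he.expand (fun X => leviCivita g X (e k) p)
    (fun X X' h => leviCivita_congr g h (EventuallyEq.refl _ _))
    (fun X X' hX hX' => leviCivita_add_left g hX hX' (he.smooth k) p)
    (fun f X hf hX => leviCivita_smul_left g hf hX (he.smooth k) p) hX
  rw [h]
  simp [connCoeff]

theorem curvCoeff_eq (he : IsOrthonormalFrameAt g e p) (hg : PreservesSmooth g)
    (i j k l : Fin n) :
    curvCoeff g e i j k l p =
      dirDeriv (e i) (connCoeff g e j k l) p - dirDeriv (e j) (connCoeff g e i k l) p
        + ∑ m, (connCoeff g e j k m p * connCoeff g e i m l p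
          - connCoeff g e i k m p * connCoeff g e j m l p
          - structCoeff g e i j m p * connCoeff g e m k l p) := by
  have h1 := he.inner_leviCivita_leviCivita hg i j k l
  have h2 := he.inner_leviCivita_leviCivita hg j i k l
  have h3 := he.inner_leviCivita_left ((he.smooth i).bracket (he.smooth j)) k l
  simp only [curvCoeff, curvature, map_sub, sub_apply]
  rw [h1, h2, h3, Finset.sum_sub_distrib, Finset.sum_sub_distrib]
  simp only [structCoeff]
  ring

/-- The curvature tensor in terms of its components in a frame. -/
theorem inner_curvature (he : IsOrthonormalFrameAt g e p) (hg : PreservesSmooth g)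
    (hn : 0 < n) {X Y Z : VField n M} (hX : IsSmoothVField X) (hY : IsSmoothVField Y)
    (hZ : IsSmoothVField Z) (l : Fin n) :
    g.inner p (curvature g X Y Z p) (e l p) =
      ∑ i, ∑ j, ∑ k, g.inner p (X p) (e i p) * g.inner p (Y p) (e j p) * g.inner p (Z p) (e k p)
        * curvCoeff g e i j k l p := by
  -- A unit frame vector serves as the nonvanishing field required by `curvature_smul_right`.
  have hne : e ⟨0, hn⟩ p ≠ 0 := by
    intro h
    have h1 := he.orthonormalAt ⟨0, hn⟩ ⟨0, hn⟩
    rw [h] at h1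
    simp at h1
  have hA := he.expand (fun X => curvature g X Y Z p)
    (fun X X' h => curvature_congr g h (EventuallyEq.refl _ _) (EventuallyEq.refl _ _))
    (fun X X' hX hX' => curvature_add_left hg hX hX' hY hZ p)
    (fun f X hf hX => curvature_smul_left hg hf hX hY hZ p) hX
  have hB := fun i => he.expand (fun Y => curvature g (e i) Y Z p)
    (fun X X' h => curvature_congr g (EventuallyEq.refl _ _) h (EventuallyEq.refl _ _))
    (fun X X' hX hX' => curvature_add_middle hg (he.smooth i) hX hX' hZ p)
    (fun f X hf hX => curvature_smul_middle hg hf (he.smooth i) hX hZ p) hY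
  have hC := fun i j => he.expand (fun Z => curvature g (e i) (e j) Z p)
    (fun X X' h => curvature_congr g (EventuallyEq.refl _ _) (EventuallyEq.refl _ _) h)
    (fun X X' hX hX' => curvature_add_right hg (he.smooth i) (he.smooth j) hX hX' p)
    (fun f X hf hX => curvature_smul_right hg hf (he.smooth i) (he.smooth j) hX (he.smooth _) hne)
    hZ
  simp only [hA, hB, hC]
  simp [curvCoeff, Finset.mul_sum, mul_assoc]

theorem curvCoeff_swap_left (he : IsOrthonormalFrameAt g e p) (i j k l : Fin n) :
    curvCoeff g e i j k l p = -curvCoeff g e j i k l p := by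
  simp only [curvCoeff]
  rw [curvature_swap g (he.smooth i) (he.smooth j) (he.smooth k)]
  simp

theorem connCoeff_swap (he : IsOrthonormalFrameAt g e p) (i j k : Fin n) :
    connCoeff g e i j k p = -connCoeff g e i k j p := by
  have h : structCoeff g e k j i p = -structCoeff g e j k i p := by
    simp only [structCoeff]; rw [bracket_swap]; simp
  rw [he.connCoeff_eq, he.connCoeff_eq, h]
  ring

/-- Metric compatibility makes the connection coefficients skew in the last two indices. The
skewness holds on a neighbourhood of p, so it passes to their derivatives and then to the curvature.
-/
theorem curvCoeff_swap_right (he : IsOrthonormalFrameAt g e p) (hg : PreservesSmooth g)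
    (i j k l : Fin n) :
    curvCoeff g e i j k l p = -curvCoeff g e i j l k p := by
  have hev : ∀ i j k, connCoeff g e i j k =ᶠ[𝓝 p] -connCoeff g e i k j := fun i j k => by
    filter_upwards [he.eventually] with q hq using hq.connCoeff_swap i j k
  rw [he.curvCoeff_eq hg, he.curvCoeff_eq hg, dirDeriv_congr _ (hev j k l),
    dirDeriv_congr _ (hev i k l), dirDeriv_neg, dirDeriv_neg, neg_add, ← Finset.sum_neg_distrib]
  have : ∀ m, connCoeff g e j k m p * connCoeff g e i m l p
      - connCoeff g e i k m p * connCoeff g e j m l p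
      - structCoeff g e i j m p * connCoeff g e m k l p
      = -(connCoeff g e j l m p * connCoeff g e i m k p
      - connCoeff g e i l m p * connCoeff g e j m k p
      - structCoeff g e i j m p * connCoeff g e m l k p) := by
    intro m
    rw [he.connCoeff_swap j k m, he.connCoeff_swap i m l, he.connCoeff_swap i k m,
      he.connCoeff_swap j m l, he.connCoeff_swap m k l]
    ring
  rw [Finset.sum_congr rfl fun m _ => this m]
  ring

end IsOrthonormalFrameAt

end Frame

/-! ### Jacobi identity and curvature in terms of structure functions. -/

section StructCoeff

variable {n : ℕ} {M : Type*} [TopologicalSpace M] [ChartedSpace (EuclideanSpace ℝ (Fin n)) M]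
  [IsManifold (𝓡 n) ∞ M] {g : Metric n M} {e : Fin n → VField n M} {p : M}

theorem structCoeff_swap (g : Metric n M) (e : Fin n → VField n M) (i j k : Fin n) :
    structCoeff g e i j k = -structCoeff g e j i k := by
  funext q
  simp only [structCoeff, Pi.neg_apply]
  rw [bracket_swap]
  simp

theorem structCoeff_self (g : Metric n M) (e : Fin n → VField n M) (i k : Fin n) :
    structCoeff g e i i k = 0 := by
  funext q
  have := congrFun (structCoeff_swap g e i i k) q
  simp only [Pi.neg_apply, Pi.zero_apply] at this ⊢
  linarith

namespace IsOrthonormalFrameAt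

theorem inner_bracket_bracket (he : IsOrthonormalFrameAt g e p) (i j k l : Fin n) :
    g.inner p (bracket (e i) (bracket (e j) (e k)) p) (e l p) =
      dirDeriv (e i) (structCoeff g e j k l) p
        + ∑ m, structCoeff g e j k m p * structCoeff g e i m l p := by
  classical
  have key : ∀ s : Finset (Fin n),
      bracket (e i) (∑ m ∈ s, structCoeff g e j k m • e m : VField n M) p =
        ∑ m ∈ s, (dirDeriv (e i) (structCoeff g e j k m) p • e m p
          + structCoeff g e j k m p • bracket (e i) (e m) p) := by
    intro s
    induction s using Finset.induction_on with
    | empty =>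
      have := congrFun (VectorField.mlieBracket_zero_right (I := 𝓡 n) (W := e i)) p
      rw [Finset.sum_empty, Finset.sum_empty]
      exact this
    | insert m s hm ih =>
      rw [Finset.sum_insert hm, Finset.sum_insert hm, bracket_add_right _
        (((he.smooth m).smul (he.structCoeff_smooth j k m)).diffAt p)
        ((IsSmoothVField.sum s fun m =>
          (he.smooth m).smul (he.structCoeff_smooth j k m)).diffAt p),
        bracket_smul_right _ ((he.structCoeff_smooth j k m).diffAt p) ((he.smooth m).diffAt p), ih]
  have h1 := bracket_congr (EventuallyEq.refl (𝓝 p) (e i))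
    (he.eventuallyEq_sum (bracket (e j) (e k)))
  rw [h1.trans (key _)]
  simp [Finset.sum_add_distrib, he.orthonormalAt _ _]
  rfl

theorem jacobi (he : IsOrthonormalFrameAt g e p) (i j k l : Fin n) :
    dirDeriv (e i) (structCoeff g e j k l) p
      + ∑ m, structCoeff g e j k m p * structCoeff g e i m l p
      + (dirDeriv (e k) (structCoeff g e i j l) p
      + ∑ m, structCoeff g e i j m p * structCoeff g e k m l p)
      = dirDeriv (e j) (structCoeff g e i k l) p
      + ∑ m, structCoeff g e i k m p * structCoeff g e j m l p := by
  rw [← he.inner_bracket_bracket, ← he.inner_bracket_bracket, ← he.inner_bracket_bracket,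
    bracket_jacobi (he.smooth i) (he.smooth j) (he.smooth k), bracket_swap (bracket (e i) (e j))]
  simp

theorem dirDeriv_connCoeff (he : IsOrthonormalFrameAt g e p) (X : VField n M) (i j k : Fin n) :
    dirDeriv X (connCoeff g e i j k) p = (dirDeriv X (structCoeff g e i j k) p
      - dirDeriv X (structCoeff g e i k j) p - dirDeriv X (structCoeff g e j k i) p) / 2 := by
  have h : connCoeff g e i j k =ᶠ[𝓝 p] fun q => (1 / 2 : ℝ) * (structCoeff g e i j k
      + (-structCoeff g e i k j + -structCoeff g e j k i)) q := by
    filter_upwards [he.eventually] with q hq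
    rw [hq.connCoeff_eq]
    simp only [Pi.add_apply, Pi.neg_apply]
    ring
  have d1 := (he.structCoeff_smooth i j k).diffAt p
  have d2 : MDifferentiableAt (𝓡 n) 𝓘(ℝ, ℝ) (-structCoeff g e i k j) p :=
    IsSmoothFun.diffAt (he.structCoeff_smooth i k j).neg p
  have d3 : MDifferentiableAt (𝓡 n) 𝓘(ℝ, ℝ) (-structCoeff g e j k i) p :=
    IsSmoothFun.diffAt (he.structCoeff_smooth j k i).neg p
  rw [dirDeriv_congr _ h, dirDeriv_const_mul _ _ (d1.add (d2.add d3)),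
    dirDeriv_add _ d1 (d2.add d3), dirDeriv_add _ d2 d3, dirDeriv_neg, dirDeriv_neg]
  ring

/-- With the connection eliminated, the effect of the deformation on the curvature can be read off
from the rescaling of the structure functions alone. -/
theorem curvCoeff_eq_structCoeff (he : IsOrthonormalFrameAt g e p) (hg : PreservesSmooth g)
    (i j k l : Fin n) :
    curvCoeff g e i j k l p =
      (dirDeriv (e i) (structCoeff g e j k l) p - dirDeriv (e i) (structCoeff g e j l k) p
        - dirDeriv (e i) (structCoeff g e k l j) p) / 2
      - (dirDeriv (e j) (structCoeff g e i k l) p - dirDeriv (e j) (structCoeff g e i l k) p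
        - dirDeriv (e j) (structCoeff g e k l i) p) / 2
      + ∑ m, ((structCoeff g e j k m p - structCoeff g e j m k p - structCoeff g e k m j p) / 2
          * ((structCoeff g e i m l p - structCoeff g e i l m p - structCoeff g e m l i p) / 2)
        - (structCoeff g e i k m p - structCoeff g e i m k p - structCoeff g e k m i p) / 2
          * ((structCoeff g e j m l p - structCoeff g e j l m p - structCoeff g e m l j p) / 2)
        - structCoeff g e i j m p
          * ((structCoeff g e m k l p - structCoeff g e m l k p - structCoeff g e k l m p) / 2)) := by
  rw [he.curvCoeff_eq hg, he.dirDeriv_connCoeff, he.dirDeriv_connCoeff]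
  simp only [he.connCoeff_eq]

end IsOrthonormalFrameAt

end StructCoeff

/-! ### Almost contact metric structures and the operator h. -/

namespace AlmostContactMetric

section General

variable {n : ℕ} {M : Type*} [TopologicalSpace M] [ChartedSpace (EuclideanSpace ℝ (Fin n)) M]
  [IsManifold (𝓡 n) ∞ M] (S : AlmostContactMetric n M)

theorem g_φ_left (x : M) (u v : TangentSpace (𝓡 n) x) :
    S.g.inner x (S.φ x u) v = -S.g.inner x u (S.φ x v) := by
  have h := S.g_φ_φ x (S.φ x u) v
  rw [S.φ_φ, S.η_φ] at h
  have h2 := S.g_ξ x (S.φ x v)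
  rw [S.g.symm, S.η_φ] at h2
  simp at h
  rw [h2] at h
  linarith

theorem η_eq_inner (x : M) (u : TangentSpace (𝓡 n) x) : S.η x u = S.g.inner x u (S.ξ x) :=
  (S.g_ξ x u).symm

theorem η_smooth_apply {X : VField n M} (hX : IsSmoothVField X) :
    IsSmoothFun n (fun q => S.η q (X q)) := by
  simp only [η_eq_inner]
  exact metric_smooth S.g hX S.ξ_smooth

theorem φv_smooth {X : VField n M} (hX : IsSmoothVField X) : IsSmoothVField (S.φv X) := by
  unfold φv
  exact ContMDiff.clm_bundle_apply (F₁ := EuclideanSpace ℝ (Fin n))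
    (F₂ := EuclideanSpace ℝ (Fin n)) (E₁ := fun x : M => TangentSpace (𝓡 n) x)
    (E₂ := fun x : M => TangentSpace (𝓡 n) x) S.φ_smooth hX

theorem φv_smul (f : M → ℝ) (X : VField n M) : S.φv (f • X) = f • S.φv X := by
  funext q; simp [φv]

theorem φv_const_smul (c : ℝ) (X : VField n M) : S.φv (c • X) = c • S.φv X := by
  funext q; simp [φv]

theorem φv_add (X Y : VField n M) : S.φv (X + Y) = S.φv X + S.φv Y := by
  funext q; simp [φv]

theorem h_smul {f : M → ℝ} {X : VField n M} (hf : IsSmoothFun n f) (hX : IsSmoothVField X)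
    (p : M) : S.h (f • X) p = f p • S.h X p := by
  simp only [h]
  rw [S.φv_smul, bracket_smul_right _ (hf.diffAt p) ((S.φv_smooth hX).diffAt p),
    bracket_smul_right _ (hf.diffAt p) (hX.diffAt p), map_add, map_smul, map_smul]
  simp only [φv]
  module

theorem h_add {X Y : VField n M} (hX : IsSmoothVField X) (hY : IsSmoothVField Y)
    (p : M) : S.h (X + Y) p = S.h X p + S.h Y p := by
  simp only [h]
  rw [S.φv_add, bracket_add_right _ ((S.φv_smooth hX).diffAt p) ((S.φv_smooth hY).diffAt p),
    bracket_add_right _ (hX.diffAt p) (hY.diffAt p), map_add]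
  module

theorem h_congr {X Y : VField n M} {p : M} (hXY : X =ᶠ[𝓝 p] Y) : S.h X p = S.h Y p := by
  have e : S.φv X =ᶠ[𝓝 p] S.φv Y := by
    filter_upwards [hXY] with q hq
    exact congrArg (S.φ q) hq
  simp only [h]
  rw [bracket_congr (EventuallyEq.refl _ S.ξ) hXY, bracket_congr (EventuallyEq.refl _ S.ξ) e]

end General

/-! ### Adapted frames (ξ, E, φE) in dimension 3. -/

variable {M : Type*} [TopologicalSpace M] [ChartedSpace (EuclideanSpace ℝ (Fin 3)) M]
  [IsManifold (𝓡 3) ∞ M]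

/-- The frame `(ξ, E, φ E)`. -/
def frame (S : AlmostContactMetric 3 M) (E : VField 3 M) : Fin 3 → VField 3 M :=
  ![S.ξ, E, S.φv E]

/-- `E` is a smooth vector field orthogonal to `ξ`, of unit length near `p`. -/
structure IsAdaptedAt (S : AlmostContactMetric 3 M) (E : VField 3 M) (p : M) : Prop where
  smooth : IsSmoothVField E
  η_eq_zero : ∀ q, S.η q (E q) = 0
  unit : ∀ᶠ q in 𝓝 p, S.g.inner q (E q) (E q) = 1

theorem IsAdaptedAt.isOrthonormalFrameAt {S : AlmostContactMetric 3 M} {E : VField 3 M} {p : M}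
    (hE : S.IsAdaptedAt E p) : IsOrthonormalFrameAt S.g (S.frame E) p where
  smooth i := by
    fin_cases i
    · exact S.ξ_smooth
    · exact hE.smooth
    · exact S.φv_smooth hE.smooth
  ortho := by
    filter_upwards [hE.unit] with q hq
    have h1 := hE.η_eq_zero q
    have h00 : S.g.inner q (S.ξ q) (S.ξ q) = 1 := by rw [S.g_ξ, S.η_ξ]
    have h10 : S.g.inner q (E q) (S.ξ q) = 0 := by rw [S.g_ξ, h1]
    have h20 : S.g.inner q (S.φ q (E q)) (S.ξ q) = 0 := by rw [S.g_ξ, S.η_φ]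
    have h22 : S.g.inner q (S.φ q (E q)) (S.φ q (E q)) = 1 := by rw [S.g_φ_φ, h1, hq]; ring
    have h12 : S.g.inner q (E q) (S.φ q (E q)) = 0 := by
      have := S.g_φ_left q (E q) (E q)
      rw [S.g.symm] at this
      linarith
    intro i j
    fin_cases i <;> fin_cases j <;> simp [frame, φv, h00, h10, h20, h22, h12, hq] <;>
      rw [S.g.symm] <;> simp [h10, h20, h12]

/-- A smooth function on the line that is equal to `1 / √t` near `t = 1`. -/
theorem exists_contDiff_mul_self_eq_inv :
    ∃ r : ℝ → ℝ, ContDiff ℝ ∞ r ∧ r 1 = 1 ∧ ∀ᶠ t in 𝓝 (1 : ℝ), r t * r t * t = 1 := by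
  -- The bump interpolates between t near 1 and the constant 1 far away. The result f(t)t + (1 -
  -- f(t)) is positive on the whole line, so its inverse square root is smooth everywhere.
  let f : ContDiffBump (1 : ℝ) := ⟨1 / 4, 1 / 2, by norm_num, by norm_num⟩
  have hpos : ∀ t, 0 < f t * t + (1 - f t) := by
    intro t
    have h0 := f.nonneg (x := t)
    have h1 := f.le_one (x := t)
    by_cases ht : t ≤ 1 / 2
    · have : f t = 0 := f.zero_of_le_dist (by
        rw [Real.dist_eq, abs_sub_comm]
        exact le_trans (by show (1 / 2 : ℝ) ≤ 1 - t; linarith) (le_abs_self _))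
      rw [this]; norm_num
    · push Not at ht
      nlinarith
  refine ⟨fun t => (Real.sqrt (f t * t + (1 - f t)))⁻¹, ?_, by simp, ?_⟩
  · refine ContDiff.inv (ContDiff.sqrt ?_ fun t => (hpos t).ne') fun t =>
      (Real.sqrt_pos.2 (hpos t)).ne'
    exact (f.contDiff.mul contDiff_id).add (contDiff_const.sub f.contDiff)
  · filter_upwards [f.eventuallyEq_one] with t ht
    have h1 := hpos t
    have h2 : f t = 1 := ht
    simp only [h2] at h1 ⊢
    have h3 : 1 * t + (1 - 1) = t := by ring
    rw [h3] at h1 ⊢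
    rw [← mul_inv, Real.mul_self_sqrt h1.le, inv_mul_cancel₀ h1.ne']

/-- The ξ-component of X is removed globally, and the result is multiplied by r of its squared
length. This normalises it near p while keeping a smooth field on all of M, even where X vanishes.
-/
theorem exists_isAdaptedAt (S : AlmostContactMetric 3 M) {X : VField 3 M}
    (hX : IsSmoothVField X) {p : M} (h1 : S.g.inner p (X p) (X p) = 1)
    (h0 : S.g.inner p (X p) (S.ξ p) = 0) : ∃ E, S.IsAdaptedAt E p ∧ E p = X p := by
  obtain ⟨r, hr, hr0, hr1⟩ := exists_contDiff_mul_self_eq_inv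
  have hη : S.η p (X p) = 0 := by rw [S.η_eq_inner, h0]
  have hηX : IsSmoothFun 3 (fun q => -S.η q (X q)) := (S.η_smooth_apply hX).neg
  obtain ⟨Y, hYdef⟩ : ∃ Y : VField 3 M, Y = X + (fun q => -S.η q (X q)) • S.ξ := ⟨_, rfl⟩
  have hY : IsSmoothVField Y := hYdef ▸ hX.add (S.ξ_smooth.smul hηX)
  have hYη : ∀ q, S.η q (Y q) = 0 := fun q => by simp [hYdef, S.η_ξ]
  have hYp : Y p = X p := by simp [hYdef, hη]
  have hN := metric_smooth S.g hY hY
  have hNp : Tendsto (fun q => S.g.inner q (Y q) (Y q)) (𝓝 p) (𝓝 1) := by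
    have := hN.continuous.tendsto p
    rwa [hYp, h1] at this
  have hrN : IsSmoothFun 3 (fun q => r (S.g.inner q (Y q) (Y q))) := hr.contMDiff.comp hN
  refine ⟨(fun q => r (S.g.inner q (Y q) (Y q))) • Y, ⟨hY.smul hrN, fun q => ?_, ?_⟩, ?_⟩
  · simp [hYη q]
  · filter_upwards [hNp.eventually hr1] with q hq
    simp
    linarith
  · simp [hYp, h1, hr0]

variable {S : AlmostContactMetric 3 M} {E : VField 3 M} {p : M}

namespace IsAdaptedAt

theorem eventually (hE : S.IsAdaptedAt E p) : ∀ᶠ q in 𝓝 p, S.IsAdaptedAt E q := by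
  filter_upwards [hE.unit.eventually_nhds] with q hq using ⟨hE.smooth, hE.η_eq_zero, hq⟩

theorem g_self (hE : S.IsAdaptedAt E p) : S.g.inner p (E p) (E p) = 1 := hE.unit.self_of_nhds

/-- On frame fields η is constant, so dη reduces to -η([·,·])/2. The value 2 comes from dη(E, φE) =
g(E, φ²E) = -1. -/
theorem structCoeff_contact (hE : S.IsAdaptedAt E p) (hS : S.IsContactMetric) :
    structCoeff S.g (S.frame E) 0 1 0 p = 0 ∧ structCoeff S.g (S.frame E) 0 2 0 p = 0 ∧
      structCoeff S.g (S.frame E) 1 2 0 p = 2 := by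
  have h1 := hS S.ξ E S.ξ_smooth hE.smooth p
  have h2 := hS S.ξ (S.φv E) S.ξ_smooth (S.φv_smooth hE.smooth) p
  have h3 := hS E (S.φv E) hE.smooth (S.φv_smooth hE.smooth) p
  simp only [φv, hE.η_eq_zero, S.η_ξ, S.η_φ, dirDeriv_const, S.φ_φ] at h1 h2 h3
  rw [S.g.symm, S.g_ξ, S.η_φ] at h1
  rw [S.g.symm, S.g_ξ] at h2
  simp [hE.η_eq_zero, hE.g_self] at h1 h2 h3
  simp only [structCoeff, frame, Matrix.cons_val_zero, Matrix.cons_val_one, Matrix.cons_val,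
    S.g_ξ]
  refine ⟨h1, h2, ?_⟩
  linarith

/-- This is the ξ-component of the Jacobi identity for ξ, E, φE. The structure functions with last
index 0 are constant near p, so only c_120 (c_011 + c_022) = 0 survives. -/
theorem structCoeff_022 (hE : S.IsAdaptedAt E p) (hS : S.IsContactMetric) :
    structCoeff S.g (S.frame E) 0 2 2 p = -structCoeff S.g (S.frame E) 0 1 1 p := by
  obtain ⟨h1, h2, h3⟩ := hE.structCoeff_contact hS
  have e1 : structCoeff S.g (S.frame E) 0 1 0 =ᶠ[𝓝 p] fun _ => 0 := by
    filter_upwards [hE.eventually] with q hq using (hq.structCoeff_contact hS).1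
  have e2 : structCoeff S.g (S.frame E) 0 2 0 =ᶠ[𝓝 p] fun _ => 0 := by
    filter_upwards [hE.eventually] with q hq using (hq.structCoeff_contact hS).2.1
  have e3 : structCoeff S.g (S.frame E) 1 2 0 =ᶠ[𝓝 p] fun _ => 2 := by
    filter_upwards [hE.eventually] with q hq using (hq.structCoeff_contact hS).2.2
  have hJ := hE.isOrthonormalFrameAt.jacobi 0 1 2 0
  rw [dirDeriv_congr _ e1, dirDeriv_congr _ e2, dirDeriv_congr _ e3] at hJ
  simp only [dirDeriv_const, Fin.sum_univ_three, structCoeff_self, structCoeff_swap _ _ 2 1,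
    structCoeff_swap _ _ 2 0, structCoeff_swap _ _ 1 0, Pi.neg_apply, Pi.zero_apply, h1, h2,
    h3] at hJ
  linarith

theorem dirDeriv_contact (hE : S.IsAdaptedAt E p) (hS : S.IsContactMetric) (X : VField 3 M) :
    dirDeriv X (structCoeff S.g (S.frame E) 0 1 0) p = 0 ∧
      dirDeriv X (structCoeff S.g (S.frame E) 0 2 0) p = 0 ∧
      dirDeriv X (structCoeff S.g (S.frame E) 1 2 0) p = 0 ∧
      dirDeriv X (structCoeff S.g (S.frame E) 0 2 2) p =
        -dirDeriv X (structCoeff S.g (S.frame E) 0 1 1) p := by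
  have e1 : structCoeff S.g (S.frame E) 0 1 0 =ᶠ[𝓝 p] fun _ => 0 := by
    filter_upwards [hE.eventually] with q hq using (hq.structCoeff_contact hS).1
  have e2 : structCoeff S.g (S.frame E) 0 2 0 =ᶠ[𝓝 p] fun _ => 0 := by
    filter_upwards [hE.eventually] with q hq using (hq.structCoeff_contact hS).2.1
  have e3 : structCoeff S.g (S.frame E) 1 2 0 =ᶠ[𝓝 p] fun _ => 2 := by
    filter_upwards [hE.eventually] with q hq using (hq.structCoeff_contact hS).2.2
  have e4 : structCoeff S.g (S.frame E) 0 2 2 =ᶠ[𝓝 p] -structCoeff S.g (S.frame E) 0 1 1 := by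
    filter_upwards [hE.eventually] with q hq using hq.structCoeff_022 hS
  refine ⟨?_, ?_, ?_, ?_⟩
  · rw [dirDeriv_congr _ e1, dirDeriv_const]
  · rw [dirDeriv_congr _ e2, dirDeriv_const]
  · rw [dirDeriv_congr _ e3, dirDeriv_const]
  · rw [dirDeriv_congr _ e4, dirDeriv_neg]

/-- The remaining consequences of the Jacobi identity in an adapted frame. -/
theorem jacobi_contact (hE : S.IsAdaptedAt E p) (hS : S.IsContactMetric)
    (c : Fin 3 → Fin 3 → Fin 3 → M → ℝ) (hc : c = structCoeff S.g (S.frame E)) :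
    dirDeriv S.ξ (c 1 2 1) p - dirDeriv E (c 0 2 1) p + dirDeriv (S.φv E) (c 0 1 1) p
        + c 0 1 1 p * c 1 2 1 p + c 0 2 1 p * c 1 2 2 p = 0 ∧
      dirDeriv S.ξ (c 1 2 2) p + dirDeriv E (c 0 1 1) p + dirDeriv (S.φv E) (c 0 1 2) p
        + c 0 1 2 p * c 1 2 1 p - c 0 1 1 p * c 1 2 2 p = 0 := by
  obtain ⟨h1, h2, h3⟩ := hE.structCoeff_contact hS
  have h4 := hE.structCoeff_022 hS
  have hJ1 := hE.isOrthonormalFrameAt.jacobi 0 1 2 1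
  have hJ2 := hE.isOrthonormalFrameAt.jacobi 0 1 2 2
  have d := fun X => (hE.dirDeriv_contact hS X).2.2.2
  rw [← hc] at h1 h2 h3 h4 hJ1 hJ2 d
  have s0 : ∀ i k, c i i k = 0 := hc ▸ structCoeff_self _ _
  have s1 : ∀ k, c 1 0 k = -c 0 1 k := hc ▸ structCoeff_swap _ _ 1 0
  have s2 : ∀ k, c 2 0 k = -c 0 2 k := hc ▸ structCoeff_swap _ _ 2 0
  have s3 : ∀ k, c 2 1 k = -c 1 2 k := hc ▸ structCoeff_swap _ _ 2 1
  have f0 : S.frame E 0 = S.ξ := rfl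
  have f1 : S.frame E 1 = E := rfl
  have f2 : S.frame E 2 = S.φv E := rfl
  simp only [Fin.sum_univ_three, s0, s1, s2, s3, Pi.neg_apply, Pi.zero_apply, h1, h2,
    h3, h4, d, f0, f1, f2] at hJ1 hJ2
  constructor
  · linear_combination hJ1
  · linear_combination hJ2

/-- The curvature components in an adapted frame of a contact metric manifold. -/
theorem curvCoeff_contact (hE : S.IsAdaptedAt E p) (hS : S.IsContactMetric)
    (hg : PreservesSmooth S.g) (c : Fin 3 → Fin 3 → Fin 3 → M → ℝ)
    (hc : c = structCoeff S.g (S.frame E)) (A B C P Q s d : ℝ) (hA : c 0 1 1 p = A)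
    (hB : c 0 1 2 p = B) (hC : c 0 2 1 p = C) (hP : c 1 2 1 p = P) (hQ : c 1 2 2 p = Q)
    (hs : s = (B + C) / 2) (hd : d = (B - C) / 2 - 1) :
    curvCoeff S.g (S.frame E) 0 1 0 1 p = -dirDeriv S.ξ (c 0 1 1) p + 2 * s * d + A ^ 2 + s ^ 2 - 1 ∧
    curvCoeff S.g (S.frame E) 0 1 0 2 p =
      -(dirDeriv S.ξ (c 0 1 2) p + dirDeriv S.ξ (c 0 2 1) p) / 2 - 2 * A * d ∧
    curvCoeff S.g (S.frame E) 0 2 0 1 p =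
      -(dirDeriv S.ξ (c 0 1 2) p + dirDeriv S.ξ (c 0 2 1) p) / 2 - 2 * A * d ∧
    curvCoeff S.g (S.frame E) 0 2 0 2 p =
      dirDeriv S.ξ (c 0 1 1) p - 2 * s * d + A ^ 2 + s ^ 2 - 1 ∧
    curvCoeff S.g (S.frame E) 1 2 0 1 p =
      -(dirDeriv E (c 0 1 2) p + dirDeriv E (c 0 2 1) p) / 2 + dirDeriv (S.φv E) (c 0 1 1) p
        + 2 * A * P + 2 * s * Q ∧
    curvCoeff S.g (S.frame E) 1 2 0 2 p =
      dirDeriv E (c 0 1 1) p + (dirDeriv (S.φv E) (c 0 1 2) p + dirDeriv (S.φv E) (c 0 2 1) p) / 2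
        + 2 * s * P - 2 * A * Q ∧
    curvCoeff S.g (S.frame E) 0 1 1 2 p =
      -dirDeriv S.ξ (c 1 2 1) p - (dirDeriv E (c 0 1 2) p - dirDeriv E (c 0 2 1) p) / 2
        + A * P + B * Q ∧
    curvCoeff S.g (S.frame E) 0 2 1 2 p =
      -dirDeriv S.ξ (c 1 2 2) p
        - (dirDeriv (S.φv E) (c 0 1 2) p - dirDeriv (S.φv E) (c 0 2 1) p) / 2
        + C * P - A * Q ∧
    curvCoeff S.g (S.frame E) 1 2 2 1 p =
      dirDeriv E (c 1 2 2) p - dirDeriv (S.φv E) (c 1 2 1) p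
        + A ^ 2 + s ^ 2 - 1 + 2 * d - P ^ 2 - Q ^ 2 := by
  obtain ⟨h1, h2, h3⟩ := hE.structCoeff_contact hS
  have h4 := hE.structCoeff_022 hS
  have d1 := fun X => (hE.dirDeriv_contact hS X).1
  have d2 := fun X => (hE.dirDeriv_contact hS X).2.1
  have d3 := fun X => (hE.dirDeriv_contact hS X).2.2.1
  have d4 := fun X => (hE.dirDeriv_contact hS X).2.2.2
  have hR := hE.isOrthonormalFrameAt.curvCoeff_eq_structCoeff hg
  rw [← hc] at h1 h2 h3 h4 hR d1 d2 d3 d4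
  have s0 : ∀ i k, c i i k = 0 := hc ▸ structCoeff_self _ _
  have s1 : ∀ k, c 1 0 k = -c 0 1 k := hc ▸ structCoeff_swap _ _ 1 0
  have s2 : ∀ k, c 2 0 k = -c 0 2 k := hc ▸ structCoeff_swap _ _ 2 0
  have s3 : ∀ k, c 2 1 k = -c 1 2 k := hc ▸ structCoeff_swap _ _ 2 1
  have f0 : S.frame E 0 = S.ξ := rfl
  have f1 : S.frame E 1 = E := rfl
  have f2 : S.frame E 2 = S.φv E := rfl
  have dz : ∀ X : VField 3 M, dirDeriv X (0 : M → ℝ) p = 0 := fun X => dirDeriv_const X 0 p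
  simp only [hR, Fin.sum_univ_three, s0, s1, s2, s3, Pi.neg_apply, Pi.zero_apply, h1, h2,
    h3, h4, d1, d2, d3, d4, dz, dirDeriv_neg, f0, f1, f2, hA, hB, hC, hP, hQ]
  -- Here s is the diagonal entry of h and d = g(∇_ξ E, φE). The -1 in d is minus half of the
  -- constant c_120 = 2.
  subst hs hd
  refine ⟨?_, ?_, ?_, ?_, ?_, ?_, ?_, ?_, ?_⟩ <;> ring

end IsAdaptedAt

/-! ### Matrix of h and the shape of the curvature tensor. -/

theorem φv_φv (hE : ∀ q, S.η q (E q) = 0) : S.φv (S.φv E) = (-1 : ℝ) • E := by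
  funext q
  simp [φv, S.φ_φ, hE q]

theorem h_ξ (p : M) : S.h S.ξ p = 0 := by
  have h1 : S.φv S.ξ = (0 : ℝ) • S.ξ := by funext q; simp [φv, S.φ_ξ]
  have h2 : bracket S.ξ S.ξ p = 0 := congrFun (VectorField.mlieBracket_self (I := 𝓡 3)) p
  have h3 : bracket S.ξ ((0 : ℝ) • S.ξ) p = 0 := by
    have := bracket_const_smul 1 0 (S.ξ_smooth.diffAt p) S.ξ_smooth
    rw [one_smul] at this
    exact this.trans (by rw [mul_zero, zero_smul])
  simp only [h]
  rw [h1, h3, h2, map_zero, sub_zero, smul_zero]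

namespace IsAdaptedAt

theorem inner_eq (hE : S.IsAdaptedAt E p) (u v : TangentSpace (𝓡 3) p) :
    S.g.inner p u v = S.g.inner p u (S.ξ p) * S.g.inner p v (S.ξ p)
      + S.g.inner p u (E p) * S.g.inner p v (E p)
      + S.g.inner p u (S.φ p (E p)) * S.g.inner p v (S.φ p (E p)) := by
  have h := hE.isOrthonormalFrameAt.orthonormalAt.sum_inner_smul v
  have h1 := congrArg (fun w => S.g.inner p u w) h
  simp only [Fin.sum_univ_three, map_add, map_smul, smul_eq_mul] at h1
  rw [← h1]
  change S.g.inner p v (S.ξ p) * S.g.inner p u (S.ξ p)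
      + S.g.inner p v (E p) * S.g.inner p u (E p)
      + S.g.inner p v (S.φ p (E p)) * S.g.inner p u (S.φ p (E p)) = _
  ring

theorem inner_φ (hE : S.IsAdaptedAt E p) (u : TangentSpace (𝓡 3) p) :
    S.g.inner p (S.φ p u) (S.ξ p) = 0 ∧
      S.g.inner p (S.φ p u) (E p) = -S.g.inner p u (S.φ p (E p)) ∧
      S.g.inner p (S.φ p u) (S.φ p (E p)) = S.g.inner p u (E p) := by
  refine ⟨by rw [S.g_ξ, S.η_φ], S.g_φ_left p u (E p), ?_⟩
  rw [S.g_φ_φ, hE.η_eq_zero]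
  ring

/-- Since 2hE = [ξ, φE] - φ[ξ, E] and φ is skew, the entries of h are averages of the c_0jk. The
relation c_022 = -c_011 makes the matrix symmetric and trace-free. -/
theorem inner_h_frame (hE : S.IsAdaptedAt E p) (hS : S.IsContactMetric)
    (c : Fin 3 → Fin 3 → Fin 3 → M → ℝ) (hc : c = structCoeff S.g (S.frame E)) (A s : ℝ)
    (hA : c 0 1 1 p = A) (hs : s = (c 0 1 2 p + c 0 2 1 p) / 2) :
    S.g.inner p (S.h E p) (S.ξ p) = 0 ∧ S.g.inner p (S.h E p) (E p) = s ∧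
      S.g.inner p (S.h E p) (S.φ p (E p)) = -A ∧
      S.g.inner p (S.h (S.φv E) p) (S.ξ p) = 0 ∧
      S.g.inner p (S.h (S.φv E) p) (E p) = -A ∧
      S.g.inner p (S.h (S.φv E) p) (S.φ p (E p)) = -s := by
  obtain ⟨h1, h2, -⟩ := hE.structCoeff_contact hS
  have h4 := hE.structCoeff_022 hS
  have h5 : bracket S.ξ (S.φv (S.φv E)) p = (-1 : ℝ) • bracket S.ξ E p := by
    rw [φv_φv hE.η_eq_zero]
    have := bracket_const_smul 1 (-1) (S.ξ_smooth.diffAt p) hE.smooth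
    rwa [one_smul, one_mul] at this
  rw [← hc] at h1 h2 h4
  have k1 : ∀ k, c 0 1 k p = S.g.inner p (bracket S.ξ E p) (S.frame E k p) := fun k => by
    rw [hc]; rfl
  have k2 : ∀ k, c 0 2 k p = S.g.inner p (bracket S.ξ (S.φv E) p) (S.frame E k p) := fun k => by
    rw [hc]; rfl
  have f0 : S.frame E 0 p = S.ξ p := rfl
  have f1 : S.frame E 1 p = E p := rfl
  have f2 : S.frame E 2 p = S.φ p (E p) := rfl
  simp only [k1, k2, f0, f1, f2] at h1 h2 h4 hA hs
  obtain ⟨a0, a1, a2⟩ := hE.inner_φ (bracket S.ξ E p)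
  obtain ⟨b0, b1, b2⟩ := hE.inner_φ (bracket S.ξ (S.φv E) p)
  simp only [h, h5, map_smul, map_sub, smul_apply, sub_apply, smul_eq_mul, a0, a1, a2, b0, b1, b2]
  refine ⟨?_, ?_, ?_, ?_, ?_, ?_⟩ <;> linarith

theorem inner_h (hE : S.IsAdaptedAt E p) (hS : S.IsContactMetric)
    (c : Fin 3 → Fin 3 → Fin 3 → M → ℝ) (hc : c = structCoeff S.g (S.frame E)) (A s : ℝ)
    (hA : c 0 1 1 p = A) (hs : s = (c 0 1 2 p + c 0 2 1 p) / 2) {X : VField 3 M}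
    (hX : IsSmoothVField X) :
    S.g.inner p (S.h X p) (S.ξ p) = 0 ∧
      S.g.inner p (S.h X p) (E p) =
        s * S.g.inner p (X p) (E p) - A * S.g.inner p (X p) (S.φ p (E p)) ∧
      S.g.inner p (S.h X p) (S.φ p (E p)) =
        -A * S.g.inner p (X p) (E p) - s * S.g.inner p (X p) (S.φ p (E p)) := by
  obtain ⟨a0, a1, a2, b0, b1, b2⟩ := hE.inner_h_frame hS c hc A s hA hs
  have h := hE.isOrthonormalFrameAt.expand (fun X => S.h X p) (fun _ _ h => S.h_congr h)
    (fun _ _ hX hY => S.h_add hX hY p) (fun _ _ hf hX => S.h_smul hf hX p) hX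
  have h' : S.h X p = S.g.inner p (X p) (E p) • S.h E p
      + S.g.inner p (X p) (S.φ p (E p)) • S.h (S.φv E) p := by
    rw [h, Fin.sum_univ_three]
    have : S.h (S.frame E 0) p = 0 := h_ξ p
    rw [this, smul_zero, zero_add]
    rfl
  rw [h']
  simp only [map_add, map_smul, add_apply, smul_apply, smul_eq_mul, a0, a1, a2, b0, b1, b2]
  refine ⟨?_, ?_, ?_⟩ <;> ring

set_option maxHeartbeats 4000000 in
-- Skewness in the first and in the last pair of indices leaves nine components in dimension 3. All
-- nine are prescribed, so pair symmetry is not needed. The coefficient of R₃ is F - κ because R₃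
-- vanishes on ker η and R₁ + R₃ vanishes on R(·,ξ)ξ, so that the φ-section sees F and the planes
-- containing ξ see κ.
theorem curvature_eq_of_curvCoeff (hE : S.IsAdaptedAt E p) (hS : S.IsContactMetric)
    (hg : PreservesSmooth S.g)
    (c : Fin 3 → Fin 3 → Fin 3 → M → ℝ) (hc : c = structCoeff S.g (S.frame E)) (A s : ℝ)
    (hA : c 0 1 1 p = A) (hs : s = (c 0 1 2 p + c 0 2 1 p) / 2) (F κ μ ν : ℝ)
    (r0101 : curvCoeff S.g (S.frame E) 0 1 0 1 p = -κ - μ * s - ν * A)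
    (r0102 : curvCoeff S.g (S.frame E) 0 1 0 2 p = μ * A - ν * s)
    (r0201 : curvCoeff S.g (S.frame E) 0 2 0 1 p = μ * A - ν * s)
    (r0202 : curvCoeff S.g (S.frame E) 0 2 0 2 p = -κ + μ * s + ν * A)
    (r1201 : curvCoeff S.g (S.frame E) 1 2 0 1 p = 0)
    (r1202 : curvCoeff S.g (S.frame E) 1 2 0 2 p = 0)
    (r0112 : curvCoeff S.g (S.frame E) 0 1 1 2 p = 0)
    (r0212 : curvCoeff S.g (S.frame E) 0 2 1 2 p = 0)
    (r1221 : curvCoeff S.g (S.frame E) 1 2 2 1 p = F)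
    {X Y Z : VField 3 M} (hX : IsSmoothVField X) (hY : IsSmoothVField Y) (hZ : IsSmoothVField Z) :
    curvature S.g X Y Z p = F • S.R₁ X Y Z p + (F - κ) • S.R₃ X Y Z p + μ • S.R₄ X Y Z p
      + ν • S.R₇ X Y Z p := by
  have he := hE.isOrthonormalFrameAt
  have q1 : ∀ k l, curvCoeff S.g (S.frame E) 1 0 k l p = -curvCoeff S.g (S.frame E) 0 1 k l p :=
    fun k l => he.curvCoeff_swap_left 1 0 k l
  have q2 : ∀ k l, curvCoeff S.g (S.frame E) 2 0 k l p = -curvCoeff S.g (S.frame E) 0 2 k l p :=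
    fun k l => he.curvCoeff_swap_left 2 0 k l
  have q3 : ∀ k l, curvCoeff S.g (S.frame E) 2 1 k l p = -curvCoeff S.g (S.frame E) 1 2 k l p :=
    fun k l => he.curvCoeff_swap_left 2 1 k l
  have q4 : ∀ i k l, curvCoeff S.g (S.frame E) i i k l p = 0 := fun i k l => by
    linarith [he.curvCoeff_swap_left i i k l]
  have q5 : ∀ i j, curvCoeff S.g (S.frame E) i j 1 0 p = -curvCoeff S.g (S.frame E) i j 0 1 p :=
    fun i j => he.curvCoeff_swap_right hg i j 1 0
  have q6 : ∀ i j, curvCoeff S.g (S.frame E) i j 2 0 p = -curvCoeff S.g (S.frame E) i j 0 2 p :=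
    fun i j => he.curvCoeff_swap_right hg i j 2 0
  have q7 : ∀ i j, curvCoeff S.g (S.frame E) i j 2 1 p = -curvCoeff S.g (S.frame E) i j 1 2 p :=
    fun i j => he.curvCoeff_swap_right hg i j 2 1
  have q8 : ∀ i j k, curvCoeff S.g (S.frame E) i j k k p = 0 := fun i j k => by
    linarith [he.curvCoeff_swap_right hg i j k k]
  have q9 : curvCoeff S.g (S.frame E) 1 2 1 2 p = -F := by linarith [q7 1 2]
  have hR := he.inner_curvature hg (by norm_num) hX hY hZ
  simp only [Fin.sum_univ_three] at hR
  have f0 : S.frame E 0 p = S.ξ p := rfl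
  have f1 : S.frame E 1 p = E p := rfl
  have f2 : S.frame E 2 p = S.φ p (E p) := rfl
  obtain ⟨x0, x1, x2⟩ := hE.inner_h hS c hc A s hA hs hX
  obtain ⟨y0, y1, y2⟩ := hE.inner_h hS c hc A s hA hs hY
  have o := he.orthonormalAt
  have o10 : S.g.inner p (S.ξ p) (E p) = 0 := o 0 1
  have o20 : S.g.inner p (S.ξ p) (S.φ p (E p)) = 0 := o 0 2
  have o00 : S.g.inner p (S.ξ p) (S.ξ p) = 1 := o 0 0
  have hRHS : ∀ l, S.g.inner p (F • S.R₁ X Y Z p + (F - κ) • S.R₃ X Y Z p + μ • S.R₄ X Y Z p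
      + ν • S.R₇ X Y Z p) (S.frame E l p) = F * S.g.inner p (S.R₁ X Y Z p) (S.frame E l p)
      + (F - κ) * S.g.inner p (S.R₃ X Y Z p) (S.frame E l p)
      + μ * S.g.inner p (S.R₄ X Y Z p) (S.frame E l p)
      + ν * S.g.inner p (S.R₇ X Y Z p) (S.frame E l p) := fun l => by simp
  refine o.ext fun l => ?_
  rw [hR l, hRHS l]
  simp only [R₁, R₃, R₄, R₇, map_add, map_sub, map_smul, add_apply, sub_apply, smul_apply,
    smul_eq_mul, S.η_eq_inner]
  rw [hE.inner_eq (X p) (Z p), hE.inner_eq (Y p) (Z p), hE.inner_eq (S.h X p) (Z p),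
    hE.inner_eq (S.h Y p) (Z p), hE.inner_eq (S.φ p (S.h X p)) (Z p),
    hE.inner_eq (S.φ p (S.h Y p)) (Z p)]
  simp only [(hE.inner_φ (S.h X p)).1, (hE.inner_φ (S.h X p)).2.1, (hE.inner_φ (S.h X p)).2.2,
    (hE.inner_φ (S.h Y p)).1, (hE.inner_φ (S.h Y p)).2.1, (hE.inner_φ (S.h Y p)).2.2,
    x0, x1, x2, y0, y1, y2, f0, f1, f2]
  fin_cases l
  all_goals
    simp only [Fin.zero_eta, Fin.mk_one, Fin.reduceFinMk, f0, f1, f2,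
      (hE.inner_φ (S.h X p)).1, (hE.inner_φ (S.h X p)).2.1, (hE.inner_φ (S.h X p)).2.2,
      (hE.inner_φ (S.h Y p)).1, (hE.inner_φ (S.h Y p)).2.1, (hE.inner_φ (S.h Y p)).2.2,
      x0, x1, x2, y0, y1, y2, o00, o10, o20, r1221,
      q1, q2, q3, q4, q5, q6, q7, q8, q9, r0101, r0102, r0201, r0202, r1201, r1202, r0112, r0212]
    generalize S.g.inner p (X p) (S.ξ p) = X0, S.g.inner p (X p) (E p) = X1,
      S.g.inner p (X p) (S.φ p (E p)) = X2, S.g.inner p (Y p) (S.ξ p) = Y0,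
      S.g.inner p (Y p) (E p) = Y1, S.g.inner p (Y p) (S.φ p (E p)) = Y2,
      S.g.inner p (Z p) (S.ξ p) = Z0, S.g.inner p (Z p) (E p) = Z1,
      S.g.inner p (Z p) (S.φ p (E p)) = Z2
    ring

end IsAdaptedAt

/-! ### Behaviour under the deformation. -/

theorem deform_inner (S : AlmostContactMetric 3 M) {a : ℝ} (ha : 0 < a) (q : M)
    (u v : TangentSpace (𝓡 3) q) :
    (S.deform a ha).g.inner q u v =
      a * S.g.inner q u v + a * (a - 1) * (S.η q u * S.η q v) := by
  simp [deform, deformMetric]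

/-- Both sides of the contact condition scale by a: the correction a(a - 1)η ⊗ η drops out because
φY lies in ker η. -/
theorem deform_isContactMetric (hS : S.IsContactMetric) {a : ℝ} (ha : 0 < a) :
    (S.deform a ha).IsContactMetric := by
  intro X Y hX hY q
  have h := hS X Y hX hY q
  have e : ∀ W : VField 3 M, (fun x => (S.deform a ha).η x (W x)) = fun x => a * S.η x (W x) :=
    fun W => rfl
  have e2 : ∀ u : TangentSpace (𝓡 3) q, (S.deform a ha).η q u = a * S.η q u := fun u => rfl
  have e3 : (S.deform a ha).φ = S.φ := rfl
  rw [e, e, e2, e3, deform_inner, S.η_φ,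
    dirDeriv_const_mul _ _ ((S.η_smooth_apply hY).diffAt q),
    dirDeriv_const_mul _ _ ((S.η_smooth_apply hX).diffAt q)]
  linear_combination a * h

theorem IsAdaptedAt.deform (hE : S.IsAdaptedAt E p) {a c : ℝ} (ha : 0 < a) (hc : a * c ^ 2 = 1) :
    (S.deform a ha).IsAdaptedAt (c • E) p where
  smooth := hE.smooth.const_smul c
  η_eq_zero q := by
    change a • S.η q (c • E q) = 0
    simp [hE.η_eq_zero q]
  unit := by
    filter_upwards [hE.unit] with q hq
    rw [deform_inner]
    simp [hE.η_eq_zero q, hq]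
    linarith

/-- Against a vector of ker η the deformed metric is just a g, so these components scale by
constants. The components along ξ are covered by the contact condition instead. -/
theorem inner_const_smul_bracket {X Y : VField 3 M} (hX : IsSmoothVField X)
    (hY : IsSmoothVField Y) {a : ℝ} (ha : 0 < a) (b c d : ℝ) (q : M)
    {w : TangentSpace (𝓡 3) q} (hw : S.η q w = 0) :
    (S.deform a ha).g.inner q (bracket (b • X) (c • Y) q) (d • w) =
      a * b * c * d * S.g.inner q (bracket X Y q) w := by
  rw [deform_inner, bracket_const_smul _ _ (hX.diffAt q) hY]
  simp [hw]
  ring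

theorem IsAdaptedAt.structCoeff_deform (hE : S.IsAdaptedAt E p) {a c : ℝ} (ha : 0 < a)
    (hc : a * c ^ 2 = 1) (C C' : Fin 3 → Fin 3 → Fin 3 → M → ℝ)
    (hC : C = structCoeff S.g (S.frame E))
    (hC' : C' = structCoeff (S.deform a ha).g ((S.deform a ha).frame (c • E))) :
    C' 0 1 1 = (fun q => a⁻¹ * C 0 1 1 q) ∧ C' 0 1 2 = (fun q => a⁻¹ * C 0 1 2 q) ∧
      C' 0 2 1 = (fun q => a⁻¹ * C 0 2 1 q) ∧ C' 1 2 1 = (fun q => c * C 1 2 1 q) ∧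
      C' 1 2 2 = (fun q => c * C 1 2 2 q) := by
  have f0 : (S.deform a ha).frame (c • E) 0 = a⁻¹ • S.ξ := rfl
  have f1 : (S.deform a ha).frame (c • E) 1 = c • E := rfl
  have f2 : (S.deform a ha).frame (c • E) 2 = c • S.φv E := S.φv_const_smul c E
  have k1 : a * a⁻¹ * c * c = a⁻¹ := by
    field_simp
    linarith
  have k2 : a * c * c * c = c := by linear_combination c * hc
  have n2 : ∀ q, S.η q (S.φv E q) = 0 := fun q => S.η_φ q (E q)
  have hφ := S.φv_smooth hE.smooth
  subst hC hC'
  refine ⟨?_, ?_, ?_, ?_, ?_⟩ <;> funext q <;> simp only [structCoeff, f0, f1, f2, Pi.smul_apply]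
  · rw [inner_const_smul_bracket S.ξ_smooth hE.smooth ha _ _ _ q (hE.η_eq_zero q), k1]; rfl
  · rw [inner_const_smul_bracket S.ξ_smooth hE.smooth ha _ _ _ q (n2 q), k1]; rfl
  · rw [inner_const_smul_bracket S.ξ_smooth hφ ha _ _ _ q (hE.η_eq_zero q), k1]; rfl
  · rw [inner_const_smul_bracket hE.smooth hφ ha _ _ _ q (hE.η_eq_zero q), k2]; rfl
  · rw [inner_const_smul_bracket hE.smooth hφ ha _ _ _ q (n2 q), k2]; rfl

/-- The curvature components determined by the `(κ, μ, ν)`-condition. -/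
theorem IsAdaptedAt.curvCoeff_kappaMuNu (hE : S.IsAdaptedAt E p) {κ μ ν : M → ℝ}
    (hS : S.IsKappaMuNu κ μ ν)
    (c : Fin 3 → Fin 3 → Fin 3 → M → ℝ) (hc : c = structCoeff S.g (S.frame E)) (A s : ℝ)
    (hA : c 0 1 1 p = A) (hs : s = (c 0 1 2 p + c 0 2 1 p) / 2) :
    curvCoeff S.g (S.frame E) 0 1 0 1 p = -κ p - μ p * s - ν p * A ∧
      curvCoeff S.g (S.frame E) 0 1 0 2 p = μ p * A - ν p * s ∧
      curvCoeff S.g (S.frame E) 0 2 0 2 p = -κ p + μ p * s + ν p * A ∧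
      curvCoeff S.g (S.frame E) 1 2 0 1 p = 0 ∧ curvCoeff S.g (S.frame E) 1 2 0 2 p = 0 := by
  have hφ := S.φv_smooth hE.smooth
  have h01 := hS.curvature_ξ S.ξ E S.ξ_smooth hE.smooth p
  have h02 := hS.curvature_ξ S.ξ (S.φv E) S.ξ_smooth hφ p
  have h12 := hS.curvature_ξ E (S.φv E) hE.smooth hφ p
  have n1 := hE.η_eq_zero p
  have n2 : S.η p (S.φv E p) = 0 := S.η_φ p (E p)
  obtain ⟨a0, a1, a2, b0, b1, b2⟩ := hE.inner_h_frame hS.contact c hc A s hA hs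
  have o := hE.isOrthonormalFrameAt.orthonormalAt
  have o12 : S.g.inner p (E p) (S.φ p (E p)) = 0 := o 1 2
  have o11 : S.g.inner p (E p) (E p) = 1 := o 1 1
  have o21 : S.g.inner p (S.φv E p) (E p) = 0 := o 2 1
  have o22 : S.g.inner p (S.φv E p) (S.φ p (E p)) = 1 := o 2 2
  have f0 : S.frame E 0 = S.ξ := rfl
  have f1 : S.frame E 1 = E := rfl
  have f2 : S.frame E 2 = S.φv E := rfl
  have f2' : S.φv E p = S.φ p (E p) := rfl
  simp only [curvCoeff, f0, f1, f2, h01, h02, h12, n1, n2, S.η_ξ, map_add, map_sub, map_smul,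
    add_apply, sub_apply, smul_apply, smul_eq_mul, (hE.inner_φ (S.h E p)).2.1,
    (hE.inner_φ (S.h (S.φv E) p)).2.1]
  simp only [f2'] at o21 o22 ⊢
  simp only [(hE.inner_φ (S.h E p)).2.2, (hE.inner_φ (S.h (S.φv E) p)).2.2, a1, a2, b1, b2, o11,
    o12, o21, o22]
  refine ⟨?_, ?_, ?_, ?_, ?_⟩ <;> ring

/-- The field that witnesses F need not be adapted. By tensoriality of the curvature only its value
at p matters, and there it agrees with E. -/
theorem IsAdaptedAt.curvCoeff_phiSectional (hE : S.IsAdaptedAt E p) (hg : PreservesSmooth S.g)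
    {X : VField 3 M} (hX : IsSmoothVField X) (hEX : E p = X p) :
    S.g.inner p (curvature S.g X (S.φv X) (S.φv X) p) (X p) =
      curvCoeff S.g (S.frame E) 1 2 2 1 p := by
  have he := hE.isOrthonormalFrameAt
  have hφ := S.φv_smooth hX
  have h := he.inner_curvature hg (by norm_num) hX hφ hφ 1
  have e1 : X p = S.frame E 1 p := hEX.symm
  have e2 : S.φv X p = S.frame E 2 p := by
    change S.φ p (X p) = S.φ p (E p)
    rw [hEX]
  rw [e1, e2] at h
  simp only [he.orthonormalAt _ _] at h
  rw [e1, h]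
  simp

end AlmostContactMetric

end ContactMetric

end

/-! ### The deformed curvature tensor. -/

theorem mainTheorem4 {M : Type*} [TopologicalSpace M] [T2Space M]
    [ChartedSpace (EuclideanSpace ℝ (Fin 3)) M] [IsManifold (𝓡 3) ∞ M]
    (S : ContactMetric.AlmostContactMetric 3 M) (κ μ ν F : M → ℝ)
    (hS : S.IsKappaMuNu κ μ ν) (hF : ∀ p, S.IsPhiSectionalCurvatureAt p (F p))
    (a : ℝ) (ha : 0 < a) (X Y Z : ContactMetric.VField 3 M)
    (hX : ContactMetric.IsSmoothVField X) (hY : ContactMetric.IsSmoothVField Y)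
    (hZ : ContactMetric.IsSmoothVField Z) (p : M) :
    ContactMetric.curvature (S.deform a ha).g X Y Z p =
      (F p / a - (a - 1) * (3 * a + 1 - κ p) / a ^ 2) • (S.deform a ha).R₁ X Y Z p
      + (F p / a + ((a - 2) * κ p - 4 * a ^ 2 + 2 * a + 2) / a ^ 2) • (S.deform a ha).R₃ X Y Z p
      + ((μ p + 2 * a - 2) / a) • (S.deform a ha).R₄ X Y Z p
      + (ν p / a) • (S.deform a ha).R₇ X Y Z p := by
  -- On ker η the deformed metric is a g, so cE has unit length for it.
  obtain ⟨c, hc⟩ : ∃ c : ℝ, a * c ^ 2 = 1 :=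
    ⟨(Real.sqrt a)⁻¹, by rw [inv_pow, Real.sq_sqrt ha.le, mul_inv_cancel₀ ha.ne']⟩
  -- The field in the definition of the φ-sectional curvature supplies a global smooth field, unit
  -- and orthogonal to ξ at q, from which an adapted frame is built.
  have hadapted : ∀ q, ∃ E, S.IsAdaptedAt E q := fun q => by
    obtain ⟨W, hW, hW1, hW0, -⟩ := hF q
    obtain ⟨E, hE, -⟩ := S.exists_isAdaptedAt hW hW1 hW0
    exact ⟨E, hE⟩
  have hg : ContactMetric.PreservesSmooth S.g := ContactMetric.preservesSmooth_of_frames fun q => by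
    obtain ⟨E, hE⟩ := hadapted q
    exact ⟨_, hE.isOrthonormalFrameAt⟩
  have hg' : ContactMetric.PreservesSmooth (S.deform a ha).g :=
    ContactMetric.preservesSmooth_of_frames fun q => by
      obtain ⟨E, hE⟩ := hadapted q
      exact ⟨_, (hE.deform ha hc).isOrthonormalFrameAt⟩
  obtain ⟨W, hW, hW1, hW0, hWF⟩ := hF p
  obtain ⟨E, hE, hEW⟩ := S.exists_isAdaptedAt hW hW1 hW0
  rw [hE.curvCoeff_phiSectional hg hW hEW] at hWF
  obtain ⟨C, hC⟩ : ∃ C, C = ContactMetric.structCoeff S.g (S.frame E) := ⟨_, rfl⟩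
  obtain ⟨C', hC'⟩ : ∃ C', C' = ContactMetric.structCoeff (S.deform a ha).g
    ((S.deform a ha).frame (c • E)) := ⟨_, rfl⟩
  obtain ⟨c011, c012, c021, c121, c122⟩ := hE.structCoeff_deform ha hc C C' hC hC'
  have hd : ∀ i j k, MDifferentiableAt (𝓡 3) 𝓘(ℝ, ℝ) (C i j k) p := fun i j k => by
    rw [hC]
    exact (hE.isOrthonormalFrameAt.structCoeff_smooth i j k).diffAt p
  have hξ : (S.deform a ha).ξ = a⁻¹ • S.ξ := rfl
  have hφ : (S.deform a ha).φv (c • E) = c • S.φv E := S.φv_const_smul c E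
  have hcon := ContactMetric.AlmostContactMetric.deform_isContactMetric hS.contact ha
  obtain ⟨r1, r2, r3, r4, r5, r6, r7, r8, r9⟩ := hE.curvCoeff_contact hS.contact hg C hC
    _ _ _ _ _ _ _ rfl rfl rfl rfl rfl rfl rfl
  obtain ⟨k1, k2, k4, k5, k6⟩ := hE.curvCoeff_kappaMuNu hS C hC _ _ rfl rfl
  obtain ⟨j1, j2⟩ := hE.jacobi_contact hS.contact C hC
  obtain ⟨t1, t2, t3, t4, t5, t6, t7, t8, t9⟩ := (hE.deform ha hc).curvCoeff_contact hcon hg' C' hC'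
    _ _ _ _ _ _ _ rfl rfl rfl rfl rfl rfl rfl
  rw [r1] at k1
  rw [r2] at k2
  rw [r4] at k4
  rw [r5] at k5
  rw [r6] at k6
  rw [r9] at hWF
  clear r1 r2 r3 r4 r5 r6 r7 r8 r9
  have hmain := fun f κ' μ' ν' => (hE.deform ha hc).curvature_eq_of_curvCoeff hcon hg' C' hC' _ _
    rfl rfl f κ' μ' ν' (X := X) (Y := Y) (Z := Z)
  simp only [hξ, hφ, c011, c012, c021, c121, c122, ContactMetric.dirDeriv_const_smul_left,
    ContactMetric.dirDeriv_const_mul _ _ (hd _ _ _)] at t1 t2 t3 t4 t5 t6 t7 t8 t9 hmain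
  generalize C 0 1 1 p = A, C 0 1 2 p = B, C 0 2 1 p = D, C 1 2 1 p = P, C 1 2 2 p = Q at *
  -- In the sum of `k1` and `k4` the derivative, μ and ν terms cancel, which leaves κ = 1 - A² - s².
  have hκ : κ p = 1 - A ^ 2 - ((B + D) / 2) ^ 2 := by linarith
  have ha0 := ha.ne'
  have hc2 : c ^ 2 = a⁻¹ := eq_inv_of_mul_eq_one_right hc
  -- The R₃ coefficient is put in the form F' - κ', from which unification with `hmain` reads off κ'
  -- = (κ + a² - 1)/a².
  have hf3 : F p / a + ((a - 2) * κ p - 4 * a ^ 2 + 2 * a + 2) / a ^ 2 =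
      (F p / a - (a - 1) * (3 * a + 1 - κ p) / a ^ 2) - (κ p + a ^ 2 - 1) / a ^ 2 := by
    field_simp
    ring
  rw [hf3]
  refine hmain _ _ _ _ ?_ ?_ ?_ ?_ ?_ ?_ ?_ ?_ ?_ hX hY hZ
  -- The components R(ξ,·)ξ carry the weight 1/a². The change of d to (d + 1)/a - 1 accounts for the
  -- shift 2a - 2 in μ'.
  · rw [t1]
    linear_combination (norm := (field_simp; ring)) a⁻¹ ^ 2 * k1
  · rw [t2]
    linear_combination (norm := (field_simp; ring)) a⁻¹ ^ 2 * k2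
  · rw [t3]
    linear_combination (norm := (field_simp; ring)) a⁻¹ ^ 2 * k2
  · rw [t4]
    linear_combination (norm := (field_simp; ring)) a⁻¹ ^ 2 * k4
  · rw [t5]
    linear_combination c * a⁻¹ * k5
  · rw [t6]
    linear_combination c * a⁻¹ * k6
  -- The components 0112 and 0212 are not given by the curvature condition. They differ from 1201
  -- and 1202 by the Jacobi relations `j1` and `j2`, which plays the role of pair symmetry.
  · rw [t7]
    linear_combination c * a⁻¹ * (k5 - j1)
  · rw [t8]
    linear_combination c * a⁻¹ * (k6 - j2)
  -- The part of F built from P, Q and their derivatives scales by c² = 1/a, while A² + s² scales by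
  -- 1/a² and is eliminated through κ.
  · rw [t9, hWF, hκ]
    linear_combination (norm := (field_simp; ring))
      (ContactMetric.dirDeriv E (C 1 2 2) p - ContactMetric.dirDeriv (S.φv E) (C 1 2 1) p
        - P ^ 2 - Q ^ 2) * hc2
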